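/- **Setting.** Let $V$ be a set of $n$ vertices with an arbitrary initial linear order, let the graph initially have no arcs, and let $m$ distinct arcs $(v,w)$, $v\neq w$, be added one at a time in a given sequence. Write $<$ for the current topological order. It is kept in a dynamic ordered list; an order query, a deletion, and an insertion next to a given element cost one unit each. Every vertex has singly linked lists of its outgoing and of its incoming arcs. Vertex sets are doubly linked lists with mark bits: testing, inserting or deleting one vertex costs one unit, and scanning or discarding a set costs one unit per member. Drawing a random position costs one unit. When $(v,w)$ is added and $v<w$, the arc is merely inserted. When $v>w$, a *soft-threshold search* is done. It maintains sets $F$, $B$ of forward and backward vertices, for $x\in F$ (resp. $x \in B$) a pointer $\mathit{out}(x)$ (resp. $\mathit{in}(x)$) to the first untraversed arc of the outgoing (incoming) list of $x$ (null if there is none), sets $F_A,F_P\subseteq F$ and $B_A,B_P\subseteq B$ of active and passive live vertices, and a soft threshold $s$. Initially $F=\{w\}$, $B=\{v\}$, $s=v$, $F_P=B_P=\emptyset$, $F_A=\{w\}$ if $\mathit{out}(w)$ is not null and $F_A=\emptyset$ otherwise, $B_A=\{v\}$ if $\mathit{in}(v)$ is not null and $B_A=\emptyset$ otherwise. While $F_A\ne\emptyset$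 and $B_A\neq\emptyset$, do the following. 1. Choose $u\in F_A$ and $z\in B_A$ arbitrarily (the choice may depend on everything that has happened so far). * If $u<z$, traverse $(u,x)=\mathit{out}(u)$ and $(y,z)=\mathit{in}(z)$, advance these two pointers, and delete $u$ from $F_A$ (resp. $z$ from $B_A$) if its pointer has become null. If now $x\in B$, or $y\in F$, or $x=y$, then report an arc on a cycle and stop the whole computation. Otherwise, if $x\notin F$, add $x$ to $F$ with $\mathit{out}(x)$ its first outgoing arc, and to $F_A$ if it has an outgoing arc; symmetrically, if $y\notin B$, add $y$ to $B$ with $\mathit{in}(y)$ its first incoming arc, and to $B_A$ if it has an incoming arc. * If not $u<z$, move $u$ from $F_A$ to $F_P$ if $u>s$, and move $z$ from $B_A$ to $B_P$ if $z<s$. 2. If $F_A=\emptyset$, set $B_P=\emptyset$ and delete $s$ from $B_A$; then, if $F_P\ne\emptyset$, choose a new $s\in F_P$ and move all $x\in F_P$ with $x\le s$ to $F_A$. 3. If $B_A=\emptyset$, set $F_P=\emptyset$ and delete $s$ from $F_A$; then, if $B_P\neq\emptyset$, choose a new $s\in B_P$ and move all $x\in B_P$ with $x\ge s$ to $B_A$.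 If the loop ends without reporting a cycle, let $t=\min(\{v\}\cup\{x\in F:\mathit{out}(x)\ne\text{null}\})$, $F_<=\{x\in F: x<t\}$, $B_>=\{y\in B:y>t\}$, and sort the subgraphs induced by $F_<$ and by $B_>$ topologically by repeated deletion of sources. If $t=v$, move $F_<$, so sorted, just after $t$; otherwise move $B_>$ followed by $F_<$, so sorted, just before $t$. Then insert the arc $(v,w)$. **Theorem.** Suppose that each new $s$ is chosen uniformly at random from the set of choices ($F_P$ in step 2, $B_P$ in step 3). Then, under the standing assumption $m=\Omega(n)$, soft-threshold search takes $O(m^{3/2})$ expected time over $m$ arc additions. That is, for every constant $c$ there is a constant $C$ such that for all $n$ and $m$ with $n\le c\,m$, every initial order, every sequence of $m$ distinct non-loop arcs, and every rule for the choices of $u$ and $z$, the expected total number of elementary operations (initialization, searches, selections of $s$, reordering and arc insertions included) until all arcs are added or a cycle is reported is at most $C\,m^{3/2}$. -/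

import Mathlib

open scoped ENNReal

namespace SoftThreshold

/-! ### Step counting -/

/-- A value together with the number of elementary operations spent on computing it. -/
structure Timed (α : Type) where
  val : α
  time : ℕ

instance : Monad Timed where
  pure a := ⟨a, 0⟩
  bind a f := ⟨(f a.val).val, a.time + (f a.val).time⟩

/-- One elementary operation. -/
def tick : Timed Unit := ⟨(), 1⟩

/-- A randomized computation: the joint law of its value and its number of operations. -/
def Rand (α : Type) : Type := PMF (Timed α)

/-- The joint law of value and time. -/
def Rand.law {α : Type} (p : Rand α) : PMF (Timed α) := p

noncomputable instance : Monad Rand where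
  pure a := PMF.pure ⟨a, 0⟩
  bind p f := PMF.bind p fun a => PMF.map (fun b => ⟨b.val, a.time + b.time⟩) (f a.val)

noncomputable instance : MonadLift Timed Rand where
  monadLift a := PMF.pure a

/-- The expected number of operations of a randomized computation. -/
noncomputable def Rand.expectedCost {α : Type} (p : Rand α) : ℝ≥0∞ :=
  ∑' r : Timed α, p.law r * (r.time : ℝ≥0∞)

/-! ### Vertex sets

A set of vertices is kept as a doubly linked list together with one mark bit per vertex. Testing,
inserting or deleting one given vertex is one operation; visiting or discarding all members costs
one operation per member. A vertex is only ever inserted into a set that does not contain it. -/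

section Sets

variable {n : ℕ}

def isEmpty (S : List (Fin n)) : Timed Bool := ⟨S.isEmpty, 1⟩

def mem (x : Fin n) (S : List (Fin n)) : Timed Bool := ⟨decide (x ∈ S), 1⟩

def insert (x : Fin n) (S : List (Fin n)) : Timed (List (Fin n)) := ⟨x :: S, 1⟩

def delete (x : Fin n) (S : List (Fin n)) : Timed (List (Fin n)) := ⟨S.erase x, 1⟩

/-- Make a set empty, unmarking its members one by one. -/
def discard (S : List (Fin n)) : Timed (List (Fin n)) := ⟨[], S.length + 1⟩

/-- Separate the members that satisfy a test from those that do not. -/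
def split (q : Fin n → Timed Bool) : List (Fin n) → Timed (List (Fin n) × List (Fin n))
  | [] => pure ([], [])
  | x :: xs => do
    tick
    let r ← split q xs
    if ← q x then return (x :: r.1, r.2) else return (r.1, x :: r.2)

/-- Choose a member of the nonempty list `a :: l` uniformly at random: count the members, draw a
position, and walk to it. -/
noncomputable def chooseUniform (a : Fin n) (l : List (Fin n)) : Rand (Fin n) :=
  PMF.map (fun i : Fin (l.length + 1) => ⟨(a :: l).get i, (l.length + 1) + 1 + (i.val + 1)⟩)
    (PMF.uniformOfFintype (Fin (l.length + 1)))

end Sets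

/-! ### The dynamic ordered list

The topological order is a list of all the vertices. An order query, a deletion, and an insertion
just before or just after a given element are one operation each. -/

section Order

variable {n : ℕ}

/-- Does `x` occur before `y`? -/
def less (ord : List (Fin n)) (x y : Fin n) : Timed Bool :=
  ⟨decide (ord.idxOf x < ord.idxOf y), 1⟩

/-- Is `x = y` or does `x` occur before `y`? -/
def lessEq (ord : List (Fin n)) (x y : Fin n) : Timed Bool :=
  ⟨decide (ord.idxOf x ≤ ord.idxOf y), 1⟩

def removeFrom (ord : List (Fin n)) (x : Fin n) : Timed (List (Fin n)) := ⟨ord.erase x, 1⟩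

/-- Insert `x` just before `t`. -/
def insertBefore (t x : Fin n) (ord : List (Fin n)) : Timed (List (Fin n)) :=
  ⟨ord.takeWhile (· ≠ t) ++ x :: ord.dropWhile (· ≠ t), 1⟩

/-- Insert `x` just after `t`. -/
def insertAfter (t x : Fin n) (ord : List (Fin n)) : Timed (List (Fin n)) :=
  ⟨ord.takeWhile (· ≠ t) ++ t :: x :: (ord.dropWhile (· ≠ t)).tail, 1⟩

/-- Move the vertices `xs`, in this order, just before `t`. -/
def moveBefore (t : Fin n) (xs : List (Fin n)) (ord : List (Fin n)) : Timed (List (Fin n)) :=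
  xs.foldlM (fun l x => do insertBefore t x (← removeFrom l x)) ord

/-- Move the vertices `xs` just after `t`, each one directly behind `t`, so that they end up in
the reverse of the order in which they are listed. -/
def moveAfter (t : Fin n) (xs : List (Fin n)) (ord : List (Fin n)) : Timed (List (Fin n)) :=
  xs.foldlM (fun l x => do insertAfter t x (← removeFrom l x)) ord

end Order

/-! ### Linear-time topological sorting by repeated deletion of sources -/

section TopSort

variable {n : ℕ}

/-- For each arc `x → y` with `x` in `vs` and `y` in the subgraph, increase the counter of `y`. -/
def countArcs (adj : Fin n → List (Fin n)) (inSub : Fin n → Timed Bool) (vs : List (Fin n)) :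
    Timed (Fin n → ℕ) :=
  vs.foldlM (fun d x => do
    tick
    (adj x).foldlM (fun d y => do
      tick
      if ← inSub y then return Function.update d y (d y + 1) else return d) d) (fun _ => 0)

/-- The vertices among `vs` whose counter is zero. -/
def sources (d : Fin n → ℕ) (vs : List (Fin n)) : Timed (List (Fin n)) := do
  let r ← split (fun x => ⟨decide (d x = 0), 1⟩) vs
  return r.1

/-- Decrease the counters of the heads `ys` of the arcs out of a deleted source, collecting the
new sources. -/
def relax (inSub : Fin n → Timed Bool) (ys : List (Fin n)) (d : Fin n → ℕ)
    (ready : List (Fin n)) : Timed ((Fin n → ℕ) × List (Fin n)) :=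
  ys.foldlM (fun p y => do
    tick
    if ← inSub y then
      tick
      if p.1 y = 1 then return (Function.update p.1 y 0, y :: p.2)
      else return (Function.update p.1 y (p.1 y - 1), p.2)
    else return p) (d, ready)

/-- Delete sources one at a time, at most as many as the first argument says, and list them. -/
def deleteSources (adj : Fin n → List (Fin n)) (inSub : Fin n → Timed Bool) :
    ℕ → (Fin n → ℕ) → List (Fin n) → Timed (List (Fin n))
  | 0, _, _ => pure []
  | _ + 1, _, [] => pure []
  | k + 1, d, x :: ready => do
    tick
    let p ← relax inSub (adj x) d ready
    let rest ← deleteSources adj inSub k p.1 p.2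
    return x :: rest

/-- Sort the vertices `vs` topologically with respect to the arcs `x → y` with `y` in `adj x`;
`inSub` tests membership in `vs`. -/
def topSort (adj : Fin n → List (Fin n)) (inSub : Fin n → Timed Bool) (vs : List (Fin n)) :
    Timed (List (Fin n)) := do
  let d ← countArcs adj inSub vs
  let ready ← sources d vs
  deleteSources adj inSub vs.length d ready

end TopSort

/-! ### The data structures -/

/-- What is kept between searches: the outgoing list of each vertex (the heads of its outgoing
arcs), the incoming list of each vertex (the tails of its incoming arcs), the topological order,
and the pointers `out` and `inn`, whose values left over from earlier searches are never read. -/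
structure Data (n : ℕ) where
  outList : Fin n → List (Fin n)
  inList : Fin n → List (Fin n)
  order : List (Fin n)
  out : Fin n → List (Fin n)
  inn : Fin n → List (Fin n)

/-- The state of a search. `F`, `B`: forward and backward vertices; `FA`, `FP`, `BA`, `BP`: active
and passive live vertices; `s`: the soft threshold. The forward pointer of a forward vertex `x`
points to the first untraversed arc of the outgoing list of `x`, so it is represented by the
remaining part `out x` of that list, `[]` being null; likewise `inn` for backward vertices. -/
structure SearchState (n : ℕ) where
  F : List (Fin n)
  B : List (Fin n)
  FA : List (Fin n)
  FP : List (Fin n)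
  BA : List (Fin n)
  BP : List (Fin n)
  s : Fin n
  out : Fin n → List (Fin n)
  inn : Fin n → List (Fin n)

/-- The state of the whole computation: waiting to process the remaining arc additions, in the
middle of the search triggered by the arc `(v, w)`, or stopped with a reported arc on a cycle. -/
inductive Config (n : ℕ) where
  | waiting (G : Data n) (todo : List (Fin n × Fin n))
  | searching (G : Data n) (v w : Fin n) (S : SearchState n) (todo : List (Fin n × Fin n))
  | cycle (a : Fin n × Fin n)

/-- A rule for the choice of `u` from `FA` and of `z` from `BA`. The rule is arbitrary: the choice
may depend on everything that has happened so far (the list of all configurations up to now, the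
current one first), random choices included. -/
structure ChoiceRule (n : ℕ) where
  pick : List (Config n) → SearchState n → Fin n × Fin n
  fst_mem : ∀ h S, S.FA ≠ [] → (pick h S).1 ∈ S.FA
  snd_mem : ∀ h S, S.BA ≠ [] → (pick h S).2 ∈ S.BA

section Search

variable {n : ℕ}

/-- Start with no arcs and the given order. -/
def emptyGraph (order : List (Fin n)) : Timed (Data n) := do
  order.forM (fun _ => do tick; tick; tick)
  return ⟨fun _ => [], fun _ => [], order, fun _ => [], fun _ => []⟩

/-- Add the arc `(v, w)` to the front of the two incidence lists. -/
def addArc (v w : Fin n) (G : Data n) : Timed (Data n) := do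
  tick
  tick
  return { G with
    outList := Function.update G.outList v (w :: G.outList v)
    inList := Function.update G.inList w (v :: G.inList w) }

/-- Begin the search for the new arc `(v, w)`. -/
def startSearch (G : Data n) (v w : Fin n) : Timed (SearchState n) := do
  let F ← insert w []
  let B ← insert v []
  tick
  let out := Function.update G.out w (G.outList w)
  tick
  let inn := Function.update G.inn v (G.inList v)
  tick
  let FA ← if out w = [] then pure [] else insert w []
  tick
  let BA ← if inn v = [] then pure [] else insert v []
  return ⟨F, B, FA, [], BA, [], v, out, inn⟩

/-- Make `x` a forward vertex unless it already is one. -/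
def visitForward (G : Data n) (x : Fin n) (S : SearchState n) : Timed (SearchState n) := do
  if ← mem x S.F then return S
  else
    let F ← insert x S.F
    tick
    let FA ← if G.outList x = [] then pure S.FA else insert x S.FA
    return { S with F := F, FA := FA, out := Function.update S.out x (G.outList x) }

/-- Make `y` a backward vertex unless it already is one. -/
def visitBackward (G : Data n) (y : Fin n) (S : SearchState n) : Timed (SearchState n) := do
  if ← mem y S.B then return S
  else
    let B ← insert y S.B
    tick
    let BA ← if G.inList y = [] then pure S.BA else insert y S.BA
    return { S with B := B, BA := BA, inn := Function.update S.inn y (G.inList y) }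

/-- Traverse an arc `(u, x)` forward and an arc `(y, z)` backward. The result is either an arc on a
cycle, if a vertex has been reached from both directions, or the new state. In the last case of
the match, which does not arise for live vertices `u` and `z`, nothing is changed. -/
def searchStep (G : Data n) (u z : Fin n) (S : SearchState n) :
    Timed ((Fin n × Fin n) ⊕ SearchState n) :=
  match S.out u, S.inn z with
  | x :: xs, y :: ys => do
    tick
    let out := Function.update S.out u xs
    tick
    let inn := Function.update S.inn z ys
    tick
    let FA ← if xs = [] then delete u S.FA else pure S.FA
    tick
    let BA ← if ys = [] then delete z S.BA else pure S.BA
    if ← mem x S.B then return .inl (u, x)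
    else if (← mem y S.F) || y == x then return .inl (y, z)
    else
      let S₁ ← visitForward G x { S with out := out, inn := inn, FA := FA, BA := BA }
      let S₂ ← visitBackward G y S₁
      return .inr S₂
  | _, _ => do
    tick
    return .inr S

/-- The case `u > z`: `u` becomes passive if `u > s`, and `z` becomes passive if `z < s`. -/
def makePassive (ord : List (Fin n)) (u z : Fin n) (S : SearchState n) :
    Timed (SearchState n) := do
  let S₁ ← if ← less ord S.s u then do
      let FA ← delete u S.FA
      let FP ← insert u S.FP
      pure { S with FA := FA, FP := FP }
    else pure S
  if ← less ord z S.s then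
    let BA ← delete z S₁.BA
    let BP ← insert z S₁.BP
    return { S₁ with BA := BA, BP := BP }
  else return S₁

/-- The update that is done when `FA` is empty; the new `s` is a uniformly random member of
`FP`. -/
noncomputable def updateForward (ord : List (Fin n)) (S : SearchState n) :
    Rand (SearchState n) := do
  if ← isEmpty S.FA then
    let BP ← discard S.BP
    let BA ← delete S.s S.BA
    if ← isEmpty S.FP then return { S with BP := BP, BA := BA }
    else
      match S.FP with
      | [] => return { S with BP := BP, BA := BA }
      | a :: l =>
        let s ← chooseUniform a l
        let r ← split (fun x => lessEq ord x s) (a :: l)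
        return { S with BP := BP, BA := BA, s := s, FA := r.1, FP := r.2 }
  else return S

/-- The update that is done when `BA` is empty; the new `s` is a uniformly random member of
`BP`. -/
noncomputable def updateBackward (ord : List (Fin n)) (S : SearchState n) :
    Rand (SearchState n) := do
  if ← isEmpty S.BA then
    let FP ← discard S.FP
    let FA ← delete S.s S.FA
    if ← isEmpty S.BP then return { S with FP := FP, FA := FA }
    else
      match S.BP with
      | [] => return { S with FP := FP, FA := FA }
      | a :: l =>
        let s ← chooseUniform a l
        let r ← split (fun x => lessEq ord s x) (a :: l)
        return { S with FP := FP, FA := FA, s := s, BA := r.1, BP := r.2 }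
  else return S

/-- The minimum of `v` and of the forward vertices with a non-null forward pointer. -/
def findT (ord : List (Fin n)) (v : Fin n) (S : SearchState n) : Timed (Fin n) :=
  S.F.foldlM (fun t x => do
    tick
    if S.out x = [] then return t
    else if ← less ord x t then return x else return t) v

/-- Restore topological order after a search that has not found a cycle, clean up, and add the arc
`(v, w)`. Here `Fs` and `Bs` are the vertices of `F` before `t` and the vertices of `B` after `t`,
sorted topologically (`Bs` in reverse, since it is sorted by the incoming lists). -/
def finish (G : Data n) (v w : Fin n) (S : SearchState n) : Timed (Data n) := do
  let ord := G.order
  let t ← findT ord v S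
  let f ← split (fun x => less ord x t) S.F
  let b ← split (fun y => less ord t y) S.B
  let Fs ← topSort G.outList
    (fun x => do if ← mem x S.F then less ord x t else return false) f.1
  let Bs ← topSort G.inList
    (fun y => do if ← mem y S.B then less ord t y else return false) b.1
  Fs.forM (fun _ => tick)
  Bs.forM (fun _ => tick)
  tick
  let order ← if t = v then moveAfter t Fs.reverse ord
    else moveBefore t (Bs.reverse ++ Fs) ord
  let _ ← discard S.F
  let _ ← discard S.B
  let _ ← discard S.FA
  let _ ← discard S.FP
  let _ ← discard S.BA
  let _ ← discard S.BP
  addArc v w { G with order := order, out := S.out, inn := S.inn }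

/-- One step of the computation in configuration `c`, `h` being the earlier configurations (the
latest first): begin to process the next arc addition, do one iteration of the while loop of a
search, or finish a search. If no arc remains or a cycle has been reported, nothing more is done,
at no cost. -/
noncomputable def step (σ : ChoiceRule n) (h : List (Config n)) (c : Config n) :
    Rand (Config n) :=
  match c with
  | .cycle a => pure (.cycle a)
  | .waiting G [] => pure (.waiting G [])
  | .waiting G ((v, w) :: todo) => do
    if ← less G.order w v then
      let S ← startSearch G v w
      return .searching G v w S todo
    else
      let G₁ ← addArc v w G
      return .waiting G₁ todo
  | .searching G v w S todo => do
    if (← isEmpty S.FA) || (← isEmpty S.BA) then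
      let G₁ ← finish G v w S
      return .waiting G₁ todo
    else
      tick
      let p := σ.pick (c :: h) S
      let r : (Fin n × Fin n) ⊕ SearchState n ←
        if ← less G.order p.1 p.2 then searchStep G p.1 p.2 S
        else do
          let S₁ ← makePassive G.order p.1 p.2 S
          pure (Sum.inr S₁)
      match r with
      | .inl a => return .cycle a
      | .inr S₁ =>
        let S₂ ← updateForward G.order S₁
        let S₃ ← updateBackward G.order S₂
        return .searching G v w S₃ todo

/-- The first `k` steps of the computation that adds the arcs `arcs` one after the other to the
graph without arcs, together with its initialization. -/
noncomputable def run (σ : ChoiceRule n) (order : List (Fin n)) (arcs : List (Fin n × Fin n)) :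
    ℕ → Rand (List (Config n) × Config n)
  | 0 => do
    let G ← emptyGraph order
    return ([], .waiting G arcs)
  | k + 1 => do
    let r ← run σ order arcs k
    let c ← step σ r.1 r.2
    return (r.2 :: r.1, c)

/-- The expected running time of the whole computation, the limit of the expected times of its
first `k` steps. It is infinite if the computation fails to stop with positive probability. -/
noncomputable def expectedTime (σ : ChoiceRule n) (order : List (Fin n))
    (arcs : List (Fin n × Fin n)) : ℝ≥0∞ :=
  ⨆ k : ℕ, (run σ order arcs k).expectedCost

end Search

end SoftThreshold

namespace SoftThreshold

/-! ### Values and times of deterministic computations -/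

section TimedLemmas

variable {α β : Type}

/-! The proof is an amortization. A potential is attached to every configuration so that one step
never increases, in expectation, the time spent plus the potential (`wp_step_le`). Induction on the
number of steps bounds the expected time by the cost of initialization plus the initial potential
(`wp_run_le`). The inequality holds at each configuration for every legal pick of `u` and `z`, so an
adaptive choice rule does no harm.

Call two arcs related if a path leads from the head of the first to the tail of the second; among
`m` arcs there are at most `m ^ 2` ordered related pairs. Each step of a search traverses arcs `(u,
x)` and `(y, z)` with `u < z`. Of two steps, at least one ordering `(e, f)` has the `u` of `e`
before the `z` of `f`. The backward arc of `f` and the forward arc of `e` were then unrelated, and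
the new arc relates them. So a completed search with `k` steps creates at least `k ^ 2 / 2` related
pairs (`card_relatedPairs_update`). Since `2 * k ≤ q + k ^ 2 / q`, all completed searches together
take `O(q * m + m ^ 2 / q)` steps, which is `O(m ^ (3/2))` for `q = √m`. A search cut short by a
cycle adds fewer than `m` steps, because no arc is traversed twice in the same direction.

Threshold selection must cost only a constant per traversal, in expectation. Bound the live vertices
that would survive if `FA` were the next to become empty, and those that would survive if `BA` were;
the larger bound is the main term of `searchPot`. If `FA` empties with `k` passive forward vertices,
a threshold of rank `r` among them replaces `k` by at most `max (k - r) (r - 1)` in this term. That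
is `3 * k / 4` on average (`sum_rank_le`), so the expected drop pays for the `O(k)` work of
choosing, splitting and reactivating (`wp_updateForward_le`). A new vertex raises the potential by a
constant, and a passive move lowers the weight of an active vertex (`makePassive_spec`).

Reordering must be linear in the number of traversed arcs. Of two visited vertices with untraversed
arcs, one forward and one backward, either both are live or the backward one comes first. Hence only
fully scanned vertices are moved at the end (`finish_spec`). The move restores a topological order,
on which counting for the next search relies. -/

@[simp] theorem Timed.val_pure (a : α) : (pure a : Timed α).val = a := rfl

@[simp] theorem Timed.time_pure (a : α) : (pure a : Timed α).time = 0 := rfl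

@[simp] theorem Timed.val_bind (a : Timed α) (f : α → Timed β) :
    (a >>= f).val = (f a.val).val := rfl

@[simp] theorem Timed.time_bind (a : Timed α) (f : α → Timed β) :
    (a >>= f).time = a.time + (f a.val).time := rfl

@[simp] theorem Timed.time_tick : tick.time = 1 := rfl

theorem Timed.time_ite (P : Prop) [Decidable P] (a b : Timed α) :
    (if P then a else b).time = if P then a.time else b.time := by split <;> rfl

end TimedLemmas

section SetLemmas

variable {n : ℕ}

@[simp] theorem isEmpty_val (S : List (Fin n)) : (isEmpty S).val = S.isEmpty := rfl
@[simp] theorem isEmpty_time (S : List (Fin n)) : (isEmpty S).time = 1 := rfl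
@[simp] theorem mem_val (x : Fin n) (S : List (Fin n)) : (mem x S).val = decide (x ∈ S) := rfl
@[simp] theorem mem_time (x : Fin n) (S : List (Fin n)) : (mem x S).time = 1 := rfl
@[simp] theorem insert_val (x : Fin n) (S : List (Fin n)) : (insert x S).val = x :: S := rfl
@[simp] theorem insert_time (x : Fin n) (S : List (Fin n)) : (insert x S).time = 1 := rfl
@[simp] theorem delete_val (x : Fin n) (S : List (Fin n)) : (delete x S).val = S.erase x := rfl
@[simp] theorem delete_time (x : Fin n) (S : List (Fin n)) : (delete x S).time = 1 := rfl
@[simp] theorem discard_val (S : List (Fin n)) : (discard S).val = [] := rfl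
@[simp] theorem discard_time (S : List (Fin n)) : (discard S).time = S.length + 1 := rfl
@[simp] theorem less_val (ord : List (Fin n)) (x y : Fin n) :
    (less ord x y).val = decide (ord.idxOf x < ord.idxOf y) := rfl
@[simp] theorem less_time (ord : List (Fin n)) (x y : Fin n) : (less ord x y).time = 1 := rfl
@[simp] theorem lessEq_val (ord : List (Fin n)) (x y : Fin n) :
    (lessEq ord x y).val = decide (ord.idxOf x ≤ ord.idxOf y) := rfl
@[simp] theorem lessEq_time (ord : List (Fin n)) (x y : Fin n) : (lessEq ord x y).time = 1 := rfl

theorem split_val (q : Fin n → Timed Bool) (l : List (Fin n)) :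
    (split q l).val = (l.filter fun x => (q x).val, l.filter fun x => !(q x).val) := by
  induction l with
  | nil => rfl
  | cons x xs ih =>
    cases h : (q x).val <;> simp [split, ih, h]

theorem split_time_le (q : Fin n → Timed Bool) (k : ℕ) (hq : ∀ x, (q x).time ≤ k)
    (l : List (Fin n)) : (split q l).time ≤ (k + 1) * l.length := by
  induction l with
  | nil => simp [split]
  | cons x xs ih =>
    have := hq x
    have h0 : (split q (x :: xs)).time = 1 + ((split q xs).time + (q x).time) := by
      simp [split, Timed.time_ite]
    rw [h0, List.length_cons, mul_add]
    omega

theorem forM_tick_time {α : Type} (l : List α) (c : Timed PUnit) :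
    (l.forM fun _ => c).time = c.time * l.length := by
  induction l with
  | nil => rfl
  | cons x xs ih =>
    change c.time + (xs.forM fun _ => c).time = _
    rw [ih, List.length_cons]
    ring

end SetLemmas

/-! ### Expected cost with a continuation -/

section WeightedCost

variable {α β : Type}

/-- The expectation of the time of `p` plus `f` of its value. -/
noncomputable def Rand.wp (p : Rand α) (f : α → ℝ≥0∞) : ℝ≥0∞ :=
  ∑' r : Timed α, p.law r * ((r.time : ℝ≥0∞) + f r.val)

theorem tsum_pmf_pure_mul (a : α) (f : α → ℝ≥0∞) : ∑' r, PMF.pure a r * f r = f a := by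
  rw [tsum_eq_single a]
  · simp
  · intro b hb
    simp [hb]

theorem tsum_pmf_bind_mul (p : PMF α) (g : α → PMF β) (f : β → ℝ≥0∞) :
    ∑' r, (p.bind g) r * f r = ∑' a, p a * ∑' r, g a r * f r := by
  simp only [PMF.bind_apply, ← ENNReal.tsum_mul_right, ← ENNReal.tsum_mul_left]
  rw [ENNReal.tsum_comm]
  simp only [mul_assoc]

theorem tsum_pmf_map_mul (p : PMF α) (g : α → β) (f : β → ℝ≥0∞) :
    ∑' r, (p.map g) r * f r = ∑' a, p a * f (g a) := by
  rw [← PMF.bind_pure_comp, tsum_pmf_bind_mul]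
  simp only [Function.comp_apply, tsum_pmf_pure_mul]

theorem tsum_pmf_mul_add (p : PMF α) (c : ℝ≥0∞) (f : α → ℝ≥0∞) :
    ∑' r, p r * (c + f r) = c + ∑' r, p r * f r := by
  simp only [mul_add]
  rw [ENNReal.tsum_add, ENNReal.tsum_mul_right, p.tsum_coe, one_mul]

theorem Rand.wp_pure (a : α) (f : α → ℝ≥0∞) : (pure a : Rand α).wp f = f a := by
  change ∑' r : Timed α, PMF.pure (⟨a, 0⟩ : Timed α) r * ((r.time : ℝ≥0∞) + f r.val) = f a
  rw [tsum_pmf_pure_mul]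
  simp

theorem Rand.wp_lift (t : Timed α) (f : α → ℝ≥0∞) :
    (liftM t : Rand α).wp f = (t.time : ℝ≥0∞) + f t.val := by
  change ∑' r : Timed α, PMF.pure t r * ((r.time : ℝ≥0∞) + f r.val) = _
  rw [tsum_pmf_pure_mul]

/-- Costs add along a sequential composition, so the expected cost of a program can be computed
backwards through its code. -/
theorem Rand.wp_bind (p : Rand α) (g : α → Rand β) (f : β → ℝ≥0∞) :
    (p >>= g).wp f = p.wp fun a => (g a).wp f := by
  change ∑' r : Timed β, (PMF.bind p.law fun a =>
    PMF.map (fun b => (⟨b.val, a.time + b.time⟩ : Timed β)) (g a.val).law) r * _ = _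
  rw [tsum_pmf_bind_mul]
  simp only [tsum_pmf_map_mul, Nat.cast_add, add_assoc, tsum_pmf_mul_add]
  rfl

theorem Rand.wp_mono (p : Rand α) {f g : α → ℝ≥0∞} (h : ∀ a, f a ≤ g a) : p.wp f ≤ p.wp g :=
  ENNReal.tsum_le_tsum fun r => by gcongr; exact h _

theorem Rand.expectedCost_le_wp (p : Rand α) (f : α → ℝ≥0∞) : p.expectedCost ≤ p.wp f :=
  ENNReal.tsum_le_tsum fun r => by gcongr; exact le_self_add

theorem Rand.wp_chooseUniform {n : ℕ} (a : Fin n) (l : List (Fin n)) (f : Fin n → ℝ≥0∞) :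
    (chooseUniform a l).wp f = ((l.length + 1 : ℕ) : ℝ≥0∞)⁻¹ *
      ∑ i : Fin (l.length + 1),
        (((l.length + 1) + 1 + (i.val + 1) : ℕ) + f ((a :: l).get i)) := by
  change ∑' r : Timed (Fin n), (PMF.map _ (PMF.uniformOfFintype (Fin (l.length + 1)))) r * _ = _
  rw [tsum_pmf_map_mul]
  simp only [PMF.uniformOfFintype_apply, Fintype.card_fin]
  rw [ENNReal.tsum_mul_left, tsum_fintype]

end WeightedCost

/-! ### Correctness and linear running time of repeated deletion of sources -/

section TopSortCorrect

variable {n : ℕ}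

/-- Because `ys` has no repetitions, each counter is lowered at most once, and the new sources are
exactly the subgraph vertices in `ys` whose counter was `1`. -/
theorem relax_spec {P : Fin n → Prop} [DecidablePred P] {inSub : Fin n → Timed Bool}
    (hv : ∀ x, (inSub x).val = decide (P x)) (ht : ∀ x, (inSub x).time ≤ 2) :
    ∀ (ys : List (Fin n)) (d : Fin n → ℕ) (ready : List (Fin n)), ys.Nodup →
      (relax inSub ys d ready).time ≤ 4 * ys.length ∧
      (∀ y, (relax inSub ys d ready).val.1 y = if y ∈ ys ∧ P y then d y - 1 else d y) ∧
      (relax inSub ys d ready).val.2 =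
        (ys.filter fun y => P y ∧ d y = 1).reverse ++ ready := by
  intro ys
  induction ys with
  | nil => intro d ready _; simp [relax]
  | cons a ys ih =>
    intro d ready hnd
    obtain ⟨ha, hnd⟩ := List.nodup_cons.1 hnd
    have hfil : ∀ k : ℕ, (ys.filter fun y => P y ∧ (Function.update d a k) y = 1) =
        ys.filter fun y => P y ∧ d y = 1 := by
      intro k
      apply List.filter_congr
      intro y hy
      have : y ≠ a := fun h => ha (h ▸ hy)
      simp [this]
    have hta := ht a
    by_cases hP : P a
    · by_cases hd : d a = 1
      · obtain ⟨h1, h2, h3⟩ := ih (Function.update d a 0) (a :: ready) hnd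
        have key : relax inSub (a :: ys) d ready =
            ⟨(relax inSub ys (Function.update d a 0) (a :: ready)).val,
              1 + ((inSub a).time + 1) +
                (relax inSub ys (Function.update d a 0) (a :: ready)).time⟩ := by
          simp only [relax, List.foldlM_cons]
          -- Eta for structures separates value and time, so that `simp` can compute both.
          change Timed.mk _ _ = _
          simp [hv, hP, hd]
        rw [key]
        refine ⟨?_, ?_, ?_⟩
        · simp only [List.length_cons]; omega
        · intro y
          rw [h2]
          by_cases hy : y = a
          · subst hy; simp [ha, hP, hd]
          · simp [hy]
        · rw [h3, hfil]; simp [hP, hd]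
      · obtain ⟨h1, h2, h3⟩ := ih (Function.update d a (d a - 1)) ready hnd
        have key : relax inSub (a :: ys) d ready =
            ⟨(relax inSub ys (Function.update d a (d a - 1)) ready).val,
              1 + ((inSub a).time + 1) +
                (relax inSub ys (Function.update d a (d a - 1)) ready).time⟩ := by
          simp only [relax, List.foldlM_cons]
          change Timed.mk _ _ = _
          simp [hv, hP, hd]
        rw [key]
        refine ⟨?_, ?_, ?_⟩
        · simp only [List.length_cons]; omega
        · intro y
          rw [h2]
          by_cases hy : y = a
          · subst hy; simp [ha, hP]
          · simp [hy]
        · rw [h3, hfil]; simp [hd]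
    · obtain ⟨h1, h2, h3⟩ := ih d ready hnd
      have key : relax inSub (a :: ys) d ready =
          ⟨(relax inSub ys d ready).val,
            1 + (inSub a).time + (relax inSub ys d ready).time⟩ := by
        simp only [relax, List.foldlM_cons]
        change Timed.mk _ _ = _
        simp [hv, hP]
      rw [key]
      refine ⟨?_, ?_, ?_⟩
      · simp only [List.length_cons]; omega
      · intro y
        rw [h2]
        by_cases hy : y = a
        · subst hy; simp [hP]
        · simp [hy]
      · rw [h3]; simp [hP]

/-- The loop of `countArcs` over the arcs out of one vertex. -/
theorem countArcs_inner {P : Fin n → Prop} [DecidablePred P] {inSub : Fin n → Timed Bool}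
    (hv : ∀ x, (inSub x).val = decide (P x)) (ht : ∀ x, (inSub x).time ≤ 2) :
    ∀ (ys : List (Fin n)) (d : Fin n → ℕ), ys.Nodup →
      let r := ys.foldlM (fun (d : Fin n → ℕ) y => do
        tick
        if ← inSub y then return Function.update d y (d y + 1) else return d) d
      r.time ≤ 3 * ys.length ∧
      ∀ y, r.val y = d y + if y ∈ ys ∧ P y then 1 else 0 := by
  intro ys
  induction ys with
  | nil => intro d _; simp
  | cons a ys ih =>
    intro d hnd r
    obtain ⟨ha, hnd⟩ := List.nodup_cons.1 hnd
    have hta := ht a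
    obtain ⟨h1, h2⟩ := ih (if P a then Function.update d a (d a + 1) else d) hnd
    have key : r = ⟨(ys.foldlM (fun (d : Fin n → ℕ) y => do
        tick
        if ← inSub y then return Function.update d y (d y + 1) else return d)
          (if P a then Function.update d a (d a + 1) else d) : Timed _).val,
        1 + (inSub a).time + (ys.foldlM (fun (d : Fin n → ℕ) y => do
        tick
        if ← inSub y then return Function.update d y (d y + 1) else return d)
          (if P a then Function.update d a (d a + 1) else d) : Timed _).time⟩ := by
      simp only [r, List.foldlM_cons]
      change Timed.mk _ _ = _
      by_cases hP : P a <;> simp [hv, hP]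
    rw [key]
    refine ⟨?_, ?_⟩
    · simp only [List.length_cons]; omega
    · intro y
      rw [h2]
      by_cases hy : y = a
      · subst hy
        by_cases hP : P y <;> simp [hP, ha]
      · by_cases hP : P a <;> simp [hP, hy]

theorem countArcs_spec {P : Fin n → Prop} [DecidablePred P] {inSub : Fin n → Timed Bool}
    (hv : ∀ x, (inSub x).val = decide (P x)) (ht : ∀ x, (inSub x).time ≤ 2)
    (adj : Fin n → List (Fin n)) (hadj : ∀ x, (adj x).Nodup) (vs : List (Fin n)) :
    (countArcs adj inSub vs).time ≤ vs.length + 3 * (vs.map fun x => (adj x).length).sum ∧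
    ∀ y, P y → (countArcs adj inSub vs).val y = vs.countP fun x => y ∈ adj x := by
  have gen : ∀ d : Fin n → ℕ,
      let r := vs.foldlM (fun d x => do
        tick
        (adj x).foldlM (fun d y => do
          tick
          if ← inSub y then return Function.update d y (d y + 1) else return d) d) d
      r.time ≤ vs.length + 3 * (vs.map fun x => (adj x).length).sum ∧
      ∀ y, P y → r.val y = d y + vs.countP fun x => y ∈ adj x := by
    induction vs with
    | nil => intro d; simp
    | cons a vs ih =>
      intro d r
      obtain ⟨h1, h2⟩ := countArcs_inner hv ht (adj a) d (hadj a)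
      obtain ⟨h3, h4⟩ := ih ((adj a).foldlM (fun (d : Fin n → ℕ) y => do
          tick
          if ← inSub y then return Function.update d y (d y + 1) else return d) d : Timed _).val
      refine ⟨?_, ?_⟩
      · simp only [r, List.foldlM_cons, Timed.time_bind, Timed.time_tick, Timed.val_bind,
          List.map_cons, List.sum_cons, List.length_cons]
        omega
      · intro y hy
        simp only [r, List.foldlM_cons, Timed.val_bind]
        rw [h4 y hy, h2, List.countP_cons]
        by_cases hya : y ∈ adj a
        · simp [hy, hya]; omega
        · simp [hya]
  obtain ⟨h1, h2⟩ := gen fun _ => 0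
  exact ⟨h1, fun y hy => (h2 y hy).trans (zero_add _)⟩

/-- `R` is the set of vertices not yet deleted. The counters are the in-degrees from `R`, and
`ready` holds the sources of the subgraph on `R`. A vertex of least `rank` is a source, so `ready`
cannot run out before `R` does. -/
theorem deleteSources_spec {P : Fin n → Prop} [DecidablePred P] {inSub : Fin n → Timed Bool}
    (hv : ∀ x, (inSub x).val = decide (P x)) (ht : ∀ x, (inSub x).time ≤ 2)
    (adj : Fin n → List (Fin n)) (hadj : ∀ x, (adj x).Nodup)
    (rank : Fin n → ℕ) (hrank : ∀ x, P x → ∀ y ∈ adj x, P y → rank x < rank y) :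
    ∀ (k : ℕ) (R : Finset (Fin n)) (d : Fin n → ℕ) (ready : List (Fin n)),
      R.card = k → (∀ x ∈ R, P x) → ready.Nodup → (∀ x, x ∈ ready ↔ x ∈ R ∧ d x = 0) →
      (∀ y, P y → d y = (R.filter fun x => y ∈ adj x).card) →
      (∀ y, P y → y ∉ R → d y = 0) →
      let r := deleteSources adj inSub k d ready
      r.val.Nodup ∧ r.val.toFinset = R ∧ r.val.Pairwise (fun a b => a ∉ adj b) ∧
      r.time ≤ R.card + 4 * ∑ x ∈ R, (adj x).length := by
  intro k
  induction k with
  | zero =>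
    intro R d ready hk _ _ _ _ _
    rw [Finset.card_eq_zero] at hk
    subst hk
    simp [deleteSources]
  | succ k ih =>
    intro R d ready hk hRP hnd hready hd hdel
    have hne : R.Nonempty := by rw [← Finset.card_pos]; omega
    obtain ⟨x₀, hx₀, hmin⟩ := R.exists_min_image rank hne
    have hx₀d : d x₀ = 0 := by
      rw [hd x₀ (hRP _ hx₀), Finset.card_eq_zero, Finset.filter_eq_empty_iff]
      intro x hx hxx
      have := hrank x (hRP _ hx) x₀ hxx (hRP _ hx₀)
      have := hmin x hx
      omega
    cases ready with
    | nil => exact absurd ((hready x₀).2 ⟨hx₀, hx₀d⟩) (by simp)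
    | cons x ready =>
      obtain ⟨hxR, hxd⟩ := (hready x).1 (by simp)
      obtain ⟨hxr, hnd'⟩ := List.nodup_cons.1 hnd
      have hPx := hRP _ hxR
      have hnoin : ∀ b ∈ R, x ∉ adj b := by
        intro b hb hxb
        have h0 := hd x hPx
        rw [hxd, eq_comm, Finset.card_eq_zero, Finset.filter_eq_empty_iff] at h0
        exact h0 hb hxb
      obtain ⟨t1, t2, t3⟩ := relax_spec hv ht (adj x) d ready (hadj x)
      set p := relax inSub (adj x) d ready with hp
      -- The arc from `x` is itself counted. With `hdel` it follows that heads of arcs from `x` are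
      -- still in `R`, so no deleted vertex becomes ready again.
      have hinR : ∀ y ∈ adj x, P y → d y ≠ 0 := by
        intro y hy hPy h0
        have h1 := hd y hPy
        rw [h0, eq_comm, Finset.card_eq_zero, Finset.filter_eq_empty_iff] at h1
        exact h1 hxR hy
      have hd' : ∀ y, P y → p.val.1 y = ((R.erase x).filter fun z => y ∈ adj z).card := by
        intro y hy
        rw [t2 y, Finset.filter_erase]
        by_cases hyx : y ∈ adj x
        · rw [if_pos ⟨hyx, hy⟩, Finset.card_erase_of_mem (by simp [hxR, hyx]), hd y hy]
        · rw [if_neg (by tauto), Finset.erase_eq_of_notMem (by simp [hyx]), hd y hy]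
      obtain ⟨i1, i2, i3, i4⟩ := ih (R.erase x) p.val.1 p.val.2
        (by rw [Finset.card_erase_of_mem hxR]; omega)
        (fun y hy => hRP y (Finset.mem_of_mem_erase hy))
        (by
          rw [t3, List.nodup_append]
          refine ⟨List.nodup_reverse.2 ((hadj x).filter _), hnd', ?_⟩
          intro a ha b hb hab
          subst hab
          have h1 := ((hready a).1 (List.mem_cons_of_mem _ hb)).2
          simp at ha
          omega)
        (by
          intro y
          rw [t3, t2 y]
          have hry := hready y
          have hnx : x ∉ adj x := hnoin x hxR
          simp only [List.mem_cons] at hry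
          simp only [List.mem_append, List.mem_reverse, List.mem_filter, decide_eq_true_eq,
            Finset.mem_erase]
          by_cases hyx : y ∈ adj x ∧ P y
          · have h1 := hinR y hyx.1 hyx.2
            have h2 : y ≠ x := fun h => hnx (h ▸ hyx.1)
            have h3 : y ∈ R := by
              by_contra h
              exact h1 (hdel y hyx.2 h)
            have h4 : y ∉ ready := fun h => h1 (hry.1 (Or.inr h)).2
            simp only [hyx, h2, h3, h4, and_self, if_true, true_and, ne_eq, not_false_eq_true,
              or_false]
            omega
          · rw [if_neg hyx]
            constructor
            · rintro (⟨h1, h2, -⟩ | h)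
              · exact absurd ⟨h1, h2⟩ hyx
              · have := hry.1 (Or.inr h)
                exact ⟨⟨fun he => hxr (he ▸ h), this.1⟩, this.2⟩
            · rintro ⟨⟨h1, h2⟩, h3⟩
              exact Or.inr ((hry.2 ⟨h2, h3⟩).resolve_left h1))
        hd'
        (by
          intro y hy hyR
          by_cases hyx : y = x
          · subst hyx
            rw [t2, hxd]; simp
          · rw [t2, hdel y hy (by simpa [hyx] using hyR)]; simp)
      have hval : (deleteSources adj inSub (k + 1) d (x :: ready)).val =
          x :: (deleteSources adj inSub k p.val.1 p.val.2).val := rfl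
      have htime : (deleteSources adj inSub (k + 1) d (x :: ready)).time =
          1 + (p.time + ((deleteSources adj inSub k p.val.1 p.val.2).time + 0)) := rfl
      intro r
      have hmem : ∀ y, y ∈ (deleteSources adj inSub k p.val.1 p.val.2).val ↔ y ∈ R.erase x := by
        intro y; rw [← i2, List.mem_toFinset]
      refine ⟨?_, ?_, ?_, ?_⟩
      · rw [hval, List.nodup_cons]
        exact ⟨by rw [hmem]; simp, i1⟩
      · rw [hval, List.toFinset_cons, i2, Finset.insert_erase hxR]
      · rw [hval, List.pairwise_cons]
        exact ⟨fun b hb => hnoin b (Finset.mem_of_mem_erase ((hmem b).1 hb)), i3⟩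
      · rw [htime]
        have h1 := Finset.sum_erase_add R (fun x => (adj x).length) hxR
        have h2 := Finset.card_erase_add_one hxR
        omega

/-- Topological sorting is correct and takes linear time on acyclic subgraphs. -/
theorem topSort_spec {inSub : Fin n → Timed Bool} (vs : List (Fin n)) (hvs : vs.Nodup)
    (hv : ∀ x, (inSub x).val = decide (x ∈ vs)) (ht : ∀ x, (inSub x).time ≤ 2)
    (adj : Fin n → List (Fin n)) (hadj : ∀ x, (adj x).Nodup)
    (rank : Fin n → ℕ) (hrank : ∀ x ∈ vs, ∀ y ∈ adj x, y ∈ vs → rank x < rank y) :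
    (topSort adj inSub vs).val.Perm vs ∧
    (topSort adj inSub vs).val.Pairwise (fun a b => a ∉ adj b) ∧
    (topSort adj inSub vs).time ≤ 4 * vs.length + 7 * (vs.map fun x => (adj x).length).sum := by
  obtain ⟨c1, c2⟩ := countArcs_spec hv ht adj hadj vs
  set d := countArcs adj inSub vs with hd
  have hsrc : (sources d.val vs).val = vs.filter fun x => d.val x = 0 := by
    simp [sources, split_val]
  have hsrct : (sources d.val vs).time ≤ 2 * vs.length := by
    have := split_time_le (fun x => ⟨decide (d.val x = 0), 1⟩) 1 (fun _ => le_rfl) vs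
    simpa [sources] using this
  obtain ⟨i1, i2, i3, i4⟩ := deleteSources_spec hv ht adj hadj rank hrank vs.length vs.toFinset
    d.val (sources d.val vs).val (List.toFinset_card_of_nodup hvs) (by simp)
    (by rw [hsrc]; exact hvs.filter _) (by intro x; rw [hsrc]; simp)
    (by
      intro y hy
      have h := List.toFinset_filter vs fun x => decide (y ∈ adj x)
      simp only [decide_eq_true_eq] at h
      rw [c2 y hy, ← h, List.toFinset_card_of_nodup (hvs.filter _),
        List.countP_eq_length_filter])
    (by intro y hy hy'; simp at hy'; exact absurd hy hy')
  refine ⟨?_, i3, ?_⟩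
  · apply (List.perm_ext_iff_of_nodup i1 hvs).2
    intro a
    have := congrArg (a ∈ ·) i2
    simpa using this
  · have h1 : (topSort adj inSub vs).time = d.time + ((sources d.val vs).time +
      (deleteSources adj inSub vs.length d.val (sources d.val vs).val).time) := rfl
    rw [List.sum_toFinset _ hvs, List.toFinset_card_of_nodup hvs] at i4
    omega

end TopSortCorrect

/-! ### Moving vertices in the ordered list -/

section Moves

variable {n : ℕ}

theorem moveBefore_time (t : Fin n) (xs ord : List (Fin n)) :
    (moveBefore t xs ord).time = 2 * xs.length := by
  induction xs generalizing ord with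
  | nil => rfl
  | cons x xs ih =>
    have : (moveBefore t (x :: xs) ord).time = 1 + 1 +
      (moveBefore t xs (insertBefore t x (ord.erase x)).val).time := rfl
    rw [this, ih, List.length_cons]; ring

theorem moveAfter_time (t : Fin n) (xs ord : List (Fin n)) :
    (moveAfter t xs ord).time = 2 * xs.length := by
  induction xs generalizing ord with
  | nil => rfl
  | cons x xs ih =>
    have : (moveAfter t (x :: xs) ord).time = 1 + 1 +
      (moveAfter t xs (insertAfter t x (ord.erase x)).val).time := rfl
    rw [this, ih, List.length_cons]; ring

theorem takeWhile_ne_append {t : Fin n} {L : List (Fin n)} (R : List (Fin n)) (h : t ∉ L) :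
    (L ++ t :: R).takeWhile (· ≠ t) = L := by
  induction L with
  | nil => simp
  | cons a L ih =>
    simp only [List.mem_cons, not_or] at h
    rw [List.cons_append, List.takeWhile_cons_of_pos (by simpa using Ne.symm h.1), ih h.2]

theorem dropWhile_ne_append {t : Fin n} {L : List (Fin n)} (R : List (Fin n)) (h : t ∉ L) :
    (L ++ t :: R).dropWhile (· ≠ t) = t :: R := by
  induction L with
  | nil => simp
  | cons a L ih =>
    simp only [List.mem_cons, not_or] at h
    rw [List.cons_append, List.dropWhile_cons_of_pos (by simpa using Ne.symm h.1), ih h.2]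

theorem erase_append_cons {t x : Fin n} (L R : List (Fin n)) (h : x ≠ t)
    (hnd : (L ++ t :: R).Nodup) : (L ++ t :: R).erase x = L.erase x ++ t :: R.erase x := by
  by_cases hx : x ∈ L
  · have hxR : x ∉ R := by
      intro hxR
      rw [List.nodup_append] at hnd
      exact hnd.2.2 x hx x (by simp [hxR]) rfl
    rw [List.erase_append_left _ hx, List.erase_of_not_mem hxR]
  · rw [List.erase_append_right _ hx, List.erase_of_not_mem hx, List.erase_cons_tail]
    simpa using h.symm

theorem filter_notMem_cons {x : Fin n} {xs L : List (Fin n)} (hL : L.Nodup) :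
    (L.erase x).filter (· ∉ xs) = L.filter (· ∉ x :: xs) := by
  rw [hL.erase_eq_filter, List.filter_filter]
  apply List.filter_congr
  intro a _
  by_cases h : a = x <;> simp [h]

/-- `M` is the block already placed directly before `t`; it has to be general for the induction, and
uses start with `M = []`. -/
theorem moveBefore_val {t : Fin n} (xs : List (Fin n)) :
    ∀ (L M R : List (Fin n)), t ∉ xs → xs.Nodup → (∀ x ∈ xs, x ∉ M) →
      (L ++ M ++ t :: R).Nodup →
      (moveBefore t xs (L ++ M ++ t :: R)).val =
        L.filter (· ∉ xs) ++ M ++ xs ++ t :: R.filter (· ∉ xs) := by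
  induction xs with
  | nil => intro L M R _ _ _ _; simp [moveBefore]
  | cons x xs ih =>
    intro L M R ht hnd hM hN
    obtain ⟨hx, hnd⟩ := List.nodup_cons.1 hnd
    simp only [List.mem_cons, not_or] at ht
    have hxM := hM x (by simp)
    have hLM : (L ++ M).erase x = L.erase x ++ M := by
      by_cases hxL : x ∈ L
      · rw [List.erase_append_left _ hxL]
      · rw [List.erase_append_right _ hxL, List.erase_of_not_mem hxM, List.erase_of_not_mem hxL]
    have hN1 : (L.erase x ++ M ++ t :: R.erase x).Nodup := by
      rw [← hLM, ← erase_append_cons _ _ (Ne.symm ht.1) hN]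
      exact hN.erase x
    have htL : t ∉ L.erase x ++ M := by
      rw [List.nodup_append] at hN1
      exact fun h => hN1.2.2 t h t (by simp) rfl
    have hL : L.Nodup := (List.nodup_append.1 (List.nodup_append.1 hN).1).1
    have hR : R.Nodup := (List.nodup_cons.1 (List.nodup_append.1 hN).2.1).2
    have hstep : (moveBefore t (x :: xs) (L ++ M ++ t :: R)).val =
        (moveBefore t xs (L.erase x ++ (M ++ [x]) ++ t :: R.erase x)).val := by
      have : (moveBefore t (x :: xs) (L ++ M ++ t :: R)).val =
        (moveBefore t xs (insertBefore t x ((L ++ M ++ t :: R).erase x)).val).val := rfl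
      rw [this, erase_append_cons _ _ (Ne.symm ht.1) hN, hLM]
      congr 2
      simp only [insertBefore]
      rw [takeWhile_ne_append _ htL, dropWhile_ne_append _ htL]
      simp
    rw [hstep, ih _ _ _ ht.2 hnd]
    · rw [filter_notMem_cons hL, filter_notMem_cons hR]
      simp
    · intro y hy
      have := hM y (by simp [hy])
      simp only [List.mem_append, List.mem_singleton, not_or]
      exact ⟨this, fun h => hx (h ▸ hy)⟩
    · have hxe : x ∉ L.erase x ++ M ++ t :: R.erase x := by
        rw [← hLM, ← erase_append_cons _ _ (Ne.symm ht.1) hN]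
        exact hN.not_mem_erase
      have hp : (L.erase x ++ (M ++ [x]) ++ t :: R.erase x).Perm
          (x :: (L.erase x ++ M ++ t :: R.erase x)) := by
        have := List.perm_middle (a := x) (l₁ := L.erase x ++ M) (l₂ := t :: R.erase x)
        simpa using this
      rw [hp.nodup_iff, List.nodup_cons]
      exact ⟨hxe, hN1⟩

/-- Each vertex is placed directly behind `t`, in front of the block `M` of earlier ones; hence the
reversal of `xs`. -/
theorem moveAfter_val {t : Fin n} (xs : List (Fin n)) :
    ∀ (L M R : List (Fin n)), t ∉ xs → xs.Nodup → (∀ x ∈ xs, x ∉ M) →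
      (L ++ t :: (M ++ R)).Nodup →
      (moveAfter t xs (L ++ t :: (M ++ R))).val =
        L.filter (· ∉ xs) ++ t :: (xs.reverse ++ M ++ R.filter (· ∉ xs)) := by
  induction xs with
  | nil => intro L M R _ _ _ _; simp [moveAfter]
  | cons x xs ih =>
    intro L M R ht hnd hM hN
    obtain ⟨hx, hnd⟩ := List.nodup_cons.1 hnd
    simp only [List.mem_cons, not_or] at ht
    have hxM := hM x (by simp)
    have hLM : (M ++ R).erase x = M ++ R.erase x := List.erase_append_right _ hxM
    have hN1 : (L.erase x ++ t :: (M ++ R.erase x)).Nodup := by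
      rw [← hLM, ← erase_append_cons _ _ (Ne.symm ht.1) hN]
      exact hN.erase x
    have htL : t ∉ L.erase x := by
      rw [List.nodup_append] at hN1
      exact fun h => hN1.2.2 t h t (by simp) rfl
    have hL : L.Nodup := (List.nodup_append.1 hN).1
    have hR : R.Nodup :=
      (List.nodup_append.1 (List.nodup_cons.1 (List.nodup_append.1 hN).2.1).2).2.1
    have hstep : (moveAfter t (x :: xs) (L ++ t :: (M ++ R))).val =
        (moveAfter t xs (L.erase x ++ t :: ((x :: M) ++ R.erase x))).val := by
      have : (moveAfter t (x :: xs) (L ++ t :: (M ++ R))).val =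
        (moveAfter t xs (insertAfter t x ((L ++ t :: (M ++ R)).erase x)).val).val := rfl
      rw [this, erase_append_cons _ _ (Ne.symm ht.1) hN, hLM]
      congr 2
      simp only [insertAfter]
      rw [takeWhile_ne_append _ htL, dropWhile_ne_append _ htL]
      simp
    rw [hstep, ih _ _ _ ht.2 hnd]
    · rw [filter_notMem_cons hL, filter_notMem_cons hR]
      simp
    · intro y hy
      have := hM y (by simp [hy])
      simp only [List.mem_cons, not_or]
      exact ⟨fun h => hx (h ▸ hy), this⟩
    · have hxe : x ∉ L.erase x ++ t :: (M ++ R.erase x) := by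
        rw [← hLM, ← erase_append_cons _ _ (Ne.symm ht.1) hN]
        exact hN.not_mem_erase
      have hp : (L.erase x ++ t :: ((x :: M) ++ R.erase x)).Perm
          (x :: (L.erase x ++ t :: (M ++ R.erase x))) := by
        have := List.perm_middle (a := x) (l₁ := L.erase x ++ [t]) (l₂ := M ++ R.erase x)
        simpa using this
      rw [hp.nodup_iff, List.nodup_cons]
      exact ⟨hxe, hN1⟩

end Moves

/-! ### Ranks in a list -/

section Ranks

variable {n : ℕ}

/-- Going from `k` to `k + 2` adds two outer terms `k + 1` and raises each of the `k` inner terms by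
one. -/
theorem sum_max_le (k : ℕ) : 4 * ∑ j ∈ Finset.range k, max (k - 1 - j) j ≤ 3 * k ^ 2 := by
  induction k using Nat.twoStepInduction with
  | zero => simp
  | one => simp
  | more k ih _ =>
    rw [Finset.sum_range_succ, Finset.sum_range_succ']
    have : ∑ j ∈ Finset.range k, max (k + 2 - 1 - (j + 1)) (j + 1) =
        ∑ j ∈ Finset.range k, (max (k - 1 - j) j + 1) := by
      apply Finset.sum_congr rfl
      intro j hj
      have := Finset.mem_range.1 hj
      omega
    rw [this, Finset.sum_add_distrib]
    simp only [Finset.sum_const, Finset.card_range, smul_eq_mul, mul_one]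
    have h1 : max (k + 2 - 1 - 0) 0 = k + 1 := by omega
    have h2 : max (k + 2 - 1 - (k + 1)) (k + 1) = k + 1 := by omega
    rw [h1, h2]
    nlinarith

/-- Over a uniformly random member of a list, the number of members of higher rank and the number
of those of lower rank are together at most three quarters of the length on average. -/
theorem sum_rank_le {ι : Type} [LinearOrder ι] (p : Fin n → ι) (hp : Function.Injective p) (l : List (Fin n))
    (hl : l.Nodup) :
    4 * ∑ i : Fin l.length, max (l.length - l.countP fun x => p x ≤ p (l.get i))
      ((l.countP fun x => p x ≤ p (l.get i)) - 1) ≤ 3 * l.length ^ 2 := by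
  have hcard : ∀ y, (l.countP fun x => p x ≤ p y) =
      (l.toFinset.filter fun x => p x ≤ p y).card := by
    intro y
    have h := List.toFinset_filter l fun x => decide (p x ≤ p y)
    simp only [decide_eq_true_eq] at h
    rw [← h, List.toFinset_card_of_nodup (hl.filter _), List.countP_eq_length_filter]
  have hpos : ∀ i : Fin l.length, 0 < l.countP fun x => p x ≤ p (l.get i) := by
    intro i
    rw [List.countP_pos_iff]
    exact ⟨l.get i, List.get_mem _ _, by simp⟩
  have hlt : ∀ i : Fin l.length, (l.countP fun x => p x ≤ p (l.get i)) - 1 < l.length := by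
    intro i
    have := hpos i
    have := List.countP_le_length (p := fun x => decide (p x ≤ p (l.get i))) (l := l)
    omega
  have hmono : ∀ x ∈ l, ∀ y ∈ l, p x < p y →
      (l.countP fun z => p z ≤ p x) < l.countP fun z => p z ≤ p y := by
    intro x hx y hy hxy
    rw [hcard, hcard]
    apply Finset.card_lt_card
    rw [Finset.ssubset_iff_of_subset]
    · exact ⟨y, by simp [hy], by simp [hxy]⟩
    · intro z hz
      simp only [Finset.mem_filter] at hz ⊢
      exact ⟨hz.1, hz.2.trans hxy.le⟩
  -- Zero-based ranks of distinct elements permute the positions, so the sum over members is a sum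
  -- over `0, …, length - 1`.
  let ρ : Fin l.length → Fin l.length := fun i => ⟨_, hlt i⟩
  have hinj : Function.Injective ρ := by
    intro i j hij
    have h1 : (l.countP fun x => p x ≤ p (l.get i)) - 1 =
      (l.countP fun x => p x ≤ p (l.get j)) - 1 := congrArg Fin.val hij
    have h2 := hpos i
    have h3 := hpos j
    apply hl.injective_get
    apply hp
    by_contra hne
    rcases lt_or_gt_of_ne hne with h | h
    · have := hmono _ (List.get_mem _ _) _ (List.get_mem _ _) h
      omega
    · have := hmono _ (List.get_mem _ _) _ (List.get_mem _ _) h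
      omega
  have hbij := Finite.injective_iff_bijective.1 hinj
  have hsum : ∑ i : Fin l.length, max (l.length - l.countP fun x => p x ≤ p (l.get i))
      ((l.countP fun x => p x ≤ p (l.get i)) - 1) =
      ∑ j : Fin l.length, max (l.length - 1 - j.val) j.val := by
    rw [← hbij.sum_comp fun j : Fin l.length => max (l.length - 1 - j.val) j.val]
    apply Finset.sum_congr rfl
    intro i _
    have := hpos i
    simp only [ρ]
    omega
  rw [hsum, Fin.sum_univ_eq_sum_range fun j => max (l.length - 1 - j) j]
  exact sum_max_le _

/-- A uniform expectation is bounded through a sum of natural numbers; the possibly infinite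
constant `C` is kept outside that sum. -/
theorem average_le (k N : ℕ) (hk : 0 < k) (C : ℝ≥0∞) (c : Fin k → ℕ) (g : Fin k → ℝ≥0∞)
    (b : Fin k → ℕ) (hg : ∀ i, g i ≤ C + b i) (hsum : ∑ i, (c i + b i) ≤ k * N) :
    (k : ℝ≥0∞)⁻¹ * ∑ i, ((c i : ℝ≥0∞) + g i) ≤ C + N := by
  have hk0 : (k : ℝ≥0∞) ≠ 0 := by exact_mod_cast hk.ne'
  have h1 : ∑ i, ((c i : ℝ≥0∞) + g i) ≤ k * (C + N) := by
    calc ∑ i, ((c i : ℝ≥0∞) + g i) ≤ ∑ i, (C + ((c i + b i : ℕ) : ℝ≥0∞)) := by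
          apply Finset.sum_le_sum
          intro i _
          calc (c i : ℝ≥0∞) + g i ≤ c i + (C + b i) := by gcongr; exact hg i
            _ = C + ((c i + b i : ℕ) : ℝ≥0∞) := by push_cast; ring
      _ = k * C + ((∑ i, (c i + b i) : ℕ) : ℝ≥0∞) := by
          rw [Finset.sum_add_distrib]; simp
      _ ≤ k * C + ((k * N : ℕ) : ℝ≥0∞) := by gcongr
      _ = k * (C + N) := by push_cast; ring
  calc (k : ℝ≥0∞)⁻¹ * ∑ i, ((c i : ℝ≥0∞) + g i) ≤ (k : ℝ≥0∞)⁻¹ * (k * (C + N)) := by gcongr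
    _ = C + N := by
      rw [← mul_assoc, ENNReal.inv_mul_cancel hk0 (ENNReal.natCast_ne_top k), one_mul]

end Ranks

/-! ### Live vertices -/

section Live

variable {n : ℕ}

/-- The part of the invariant of a search that concerns the live vertices and the threshold. -/
structure LiveInv (p : Fin n → ℕ) (S : SearchState n) : Prop where
  nodup_F : (S.FA ++ S.FP).Nodup
  nodup_B : (S.BA ++ S.BP).Nodup
  lt_FP : ∀ x ∈ S.FP, p S.s < p x
  BP_lt : ∀ z ∈ S.BP, p z < p S.s
  live_F : ∀ x, x ∈ S.FA ∨ x ∈ S.FP → x ∈ S.F ∧ S.out x ≠ []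
  live_B : ∀ z, z ∈ S.BA ∨ z ∈ S.BP → z ∈ S.B ∧ S.inn z ≠ []
  -- This is what makes discarding vertices safe: a pair of unfinished vertices that is no longer
  -- entirely live is already in the right order.
  frontier : ∀ x ∈ S.F, S.out x ≠ [] → ∀ z ∈ S.B, S.inn z ≠ [] →
    p z < p x ∨ ((x ∈ S.FA ∨ x ∈ S.FP) ∧ (z ∈ S.BA ∨ z ∈ S.BP))

/-- The potential that pays for selections of thresholds and for passive moves. -/
def searchPot (p : Fin n → ℕ) (S : SearchState n) : ℕ :=
  -- The arguments of `max` bound the survivors if `FA`, respectively `BA`, empties next: an active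
  -- forward vertex not after `s` can only leave by exhausting its arcs, and `s` itself is deleted
  -- from the other side. The factor `112` makes an expected drop of `k / 4` worth `28 * k`. The
  -- weight `24` pays for passive moves and the weight `1` for discarding passive sets.
  112 * max ((S.FA.countP fun x => p S.s < p x) + S.FP.length + (S.BA.erase S.s).length)
      ((S.BA.countP fun z => p z < p S.s) + S.BP.length + (S.FA.erase S.s).length) +
    24 * (S.FA.length + S.BA.length) + (S.FP.length + S.BP.length)

/-- Two states of a search have the same visited vertices and pointers. -/
def SameVisited (S S' : SearchState n) : Prop :=
  S'.F = S.F ∧ S'.B = S.B ∧ S'.out = S.out ∧ S'.inn = S.inn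

/-- With `FA` empty, all live forward vertices are passive and hence after the old threshold. The
dropped backward vertices are that threshold and vertices before it, so every pair that stops being
live is in the right order. -/
theorem LiveInv.forward_choose {p : Fin n → ℕ} {S : SearchState n}
    (h : LiveInv p S) (hFA : S.FA = []) (s : Fin n) :
    LiveInv p { S with BP := [], BA := S.BA.erase S.s, s := s,
                       FA := S.FP.filter (fun x => p x ≤ p s),
                       FP := S.FP.filter (fun x => !decide (p x ≤ p s)) } := by
  obtain ⟨h1, h2, h3, h4, h5, h6, h7⟩ := h
  rw [hFA, List.nil_append] at h1
  have h2' := List.nodup_append.1 h2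
  refine ⟨?_, ?_, ?_, ?_, ?_, ?_, ?_⟩
  · have := List.filter_append_perm (fun x => decide (p x ≤ p s)) S.FP
    exact this.nodup_iff.2 h1
  · simpa using h2'.1.erase _
  · intro x hx
    simp at hx
    exact hx.2
  · simp
  · intro x hx
    apply h5
    simp at hx
    tauto
  · intro z hz
    simp only [List.not_mem_nil, or_false] at hz
    exact h6 z (Or.inl (List.mem_of_mem_erase hz))
  · intro x hx hox z hz hiz
    rcases h7 x hx hox z hz hiz with h | ⟨ha, hb⟩
    · exact Or.inl h
    · rw [hFA] at ha
      have hxP : x ∈ S.FP := by simpa using ha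
      have hlt := h3 x hxP
      by_cases hzs : z = S.s
      · subst hzs; exact Or.inl hlt
      · rcases hb with hb | hb
        · right
          refine ⟨?_, Or.inl ((List.mem_erase_of_ne hzs).2 hb)⟩
          simp only [List.mem_filter, hxP, true_and, decide_eq_true_eq, Bool.not_eq_true',
            decide_eq_false_iff_not]
          exact em _
        · exact Or.inl ((h4 z hb).trans hlt)

theorem LiveInv.backward_choose {p : Fin n → ℕ} {S : SearchState n}
    (h : LiveInv p S) (hBA : S.BA = []) (s : Fin n) :
    LiveInv p { S with FP := [], FA := S.FA.erase S.s, s := s,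
                       BA := S.BP.filter (fun x => p s ≤ p x),
                       BP := S.BP.filter (fun x => !decide (p s ≤ p x)) } := by
  obtain ⟨h1, h2, h3, h4, h5, h6, h7⟩ := h
  rw [hBA, List.nil_append] at h2
  have h1' := List.nodup_append.1 h1
  refine ⟨?_, ?_, ?_, ?_, ?_, ?_, ?_⟩
  · simpa using h1'.1.erase _
  · have := List.filter_append_perm (fun x => decide (p s ≤ p x)) S.BP
    exact this.nodup_iff.2 h2
  · simp
  · intro x hx
    simp at hx
    exact hx.2
  · intro z hz
    simp only [List.not_mem_nil, or_false] at hz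
    exact h5 z (Or.inl (List.mem_of_mem_erase hz))
  · intro x hx
    apply h6
    simp at hx
    tauto
  · intro x hx hox z hz hiz
    rcases h7 x hx hox z hz hiz with h | ⟨ha, hb⟩
    · exact Or.inl h
    · rw [hBA] at hb
      have hzP : z ∈ S.BP := by simpa using hb
      have hlt := h4 z hzP
      by_cases hxs : x = S.s
      · subst hxs; exact Or.inl hlt
      · rcases ha with ha | ha
        · right
          refine ⟨Or.inl ((List.mem_erase_of_ne hxs).2 ha), ?_⟩
          simp only [List.mem_filter, hzP, true_and, decide_eq_true_eq, Bool.not_eq_true',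
            decide_eq_false_iff_not]
          exact em _
        · exact Or.inl (hlt.trans (h3 x ha))

theorem LiveInv.forward_drop {p : Fin n → ℕ} {S : SearchState n}
    (h : LiveInv p S) (hFA : S.FA = []) (hFP : S.FP = []) :
    LiveInv p { S with BP := [], BA := S.BA.erase S.s } := by
  obtain ⟨h1, h2, h3, h4, h5, h6, h7⟩ := h
  refine ⟨h1, ?_, h3, by simp, h5, ?_, ?_⟩
  · simpa using (List.nodup_append.1 h2).1.erase _
  · intro z hz
    simp only [List.not_mem_nil, or_false] at hz
    exact h6 z (Or.inl (List.mem_of_mem_erase hz))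
  · intro x hx hox z hz hiz
    rcases h7 x hx hox z hz hiz with h | ⟨ha, hb⟩
    · exact Or.inl h
    · simp [hFA, hFP] at ha

theorem LiveInv.backward_drop {p : Fin n → ℕ} {S : SearchState n}
    (h : LiveInv p S) (hBA : S.BA = []) (hBP : S.BP = []) :
    LiveInv p { S with FP := [], FA := S.FA.erase S.s } := by
  obtain ⟨h1, h2, h3, h4, h5, h6, h7⟩ := h
  refine ⟨?_, h2, by simp, h4, ?_, h6, ?_⟩
  · simpa using (List.nodup_append.1 h1).1.erase _
  · intro z hz
    simp only [List.not_mem_nil, or_false] at hz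
    exact h5 z (Or.inl (List.mem_of_mem_erase hz))
  · intro x hx hox z hz hiz
    rcases h7 x hx hox z hz hiz with h | ⟨ha, hb⟩
    · exact Or.inl h
    · simp [hBA, hBP] at hb

theorem filter_le_length (q : Fin n → Bool) (l : List (Fin n)) :
    (l.filter q).length + (l.filter fun x => !q x).length = l.length := by
  rw [← List.length_append]
  exact (List.filter_append_perm q l).length_eq

/-- The random choice lowers the main term of `searchPot` by a quarter of the number of candidates
on average, which absorbs everything but `5` units. The continuation `f` may also assume that an
empty `FA` leaves no passive forward vertex. -/
theorem wp_updateForward_le {ord : List (Fin n)} (hp : Function.Injective fun x => ord.idxOf x)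
    {S : SearchState n} (hS : LiveInv (fun x => ord.idxOf x) S) (f : SearchState n → ℝ≥0∞)
    (C : ℝ≥0∞)
    (hf : ∀ S', LiveInv (fun x => ord.idxOf x) S' → (S'.FA = [] → S'.FP = []) → SameVisited S S' →
      f S' ≤ C + searchPot (fun x => ord.idxOf x) S') :
    (updateForward ord S).wp f ≤ C + (searchPot (fun x => ord.idxOf x) S + 5 : ℕ) := by
  by_cases hFA : S.FA = []
  · cases hFP : S.FP with
    | nil =>
      have h1 : (updateForward ord S).wp f =
          ((1 + (S.BP.length + 1) + 1 + 1 : ℕ) : ℝ≥0∞) +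
            f { S with BP := [], BA := S.BA.erase S.s } := by
        simp [updateForward, Rand.wp_bind, Rand.wp_lift, Rand.wp_pure, hFA, hFP]
        ring
      have h2 := hf _ (hS.forward_drop hFA hFP) (fun _ => hFP) ⟨rfl, rfl, rfl, rfl⟩
      rw [h1]
      refine (add_le_add_right h2 _).trans ?_
      rw [add_left_comm]
      gcongr
      norm_cast
      simp only [searchPot, hFA, hFP, List.countP_nil, List.length_nil, List.erase_nil]
      have e1 := List.length_erase_le (a := S.s) (l := S.BA)
      have e2 := List.length_erase_le (a := S.s) (l := S.BA.erase S.s)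
      have e3 := List.countP_le_length (p := fun z => decide (ord.idxOf z < ord.idxOf S.s))
        (l := S.BA.erase S.s)
      omega
    | cons a l =>
      have h1 : (updateForward ord S).wp f = ((1 + (S.BP.length + 1) + 1 + 1 : ℕ) : ℝ≥0∞) +
          (chooseUniform a l).wp (fun s => (split (fun x => lessEq ord x s) (a :: l)).time +
            f { S with BP := [], BA := S.BA.erase S.s, s := s,
                       FA := (a :: l).filter (fun x => ord.idxOf x ≤ ord.idxOf s),
                       FP := (a :: l).filter (fun x => !decide (ord.idxOf x ≤ ord.idxOf s)) }) := by
        simp [updateForward, Rand.wp_bind, Rand.wp_lift, Rand.wp_pure, hFA, hFP, split_val]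
        ring
      have hnd : (a :: l).Nodup := by
        have := hS.nodup_F
        rwa [hFA, hFP, List.nil_append] at this
      set BA' := S.BA.erase S.s with hBA'
      set k := l.length + 1 with hk
      let r : Fin k → ℕ := fun i =>
        (a :: l).countP fun x => ord.idxOf x ≤ ord.idxOf ((a :: l).get i)
      have hr := sum_rank_le (fun x => ord.idxOf x) hp (a :: l) hnd
      have h2 : (chooseUniform a l).wp (fun s => (split (fun x => lessEq ord x s) (a :: l)).time +
            f { S with BP := [], BA := BA', s := s,
                       FA := (a :: l).filter (fun x => ord.idxOf x ≤ ord.idxOf s),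
                       FP := (a :: l).filter (fun x => !decide (ord.idxOf x ≤ ord.idxOf s)) }) ≤
          C + (112 * BA'.length + 24 * BA'.length + 112 * k + k + 1: ℕ) := by
        rw [Rand.wp_chooseUniform]
        refine average_le k _ (by omega) C _ _
          -- `2 * k` pays for the split; the rest bounds the new `searchPot`. There are `r i` newly
          -- active vertices, none after the new threshold and one equal to it, and `k - r i`
          -- vertices stay passive.
          (fun i => 2 * k + (112 * (BA'.length + max (k - r i) (r i - 1)) +
            24 * (r i + BA'.length) + (k - r i))) ?_ ?_
        · intro i
          have ha := hS.forward_choose hFA ((a :: l).get i)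
          rw [hFP] at ha
          -- The new threshold itself becomes active, so the new `FA` is nonempty.
          have hmem : (a :: l).get i ∈ (a :: l).filter
              (fun x => ord.idxOf x ≤ ord.idxOf ((a :: l).get i)) := by
            rw [List.mem_filter]
            exact ⟨List.get_mem _ _, by simp⟩
          have hb := hf _ ha (fun h0 => by
            simp only [] at h0
            rw [h0] at hmem
            simp at hmem) ⟨rfl, rfl, rfl, rfl⟩
          refine (add_le_add_right hb _).trans ?_
          rw [add_left_comm]
          gcongr
          norm_cast
          have ht := split_time_le (fun x => lessEq ord x ((a :: l).get i)) 1 (fun _ => le_rfl)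
            (a :: l)
          refine Nat.add_le_add ht ?_
          have e0 := filter_le_length (fun x => ord.idxOf x ≤ ord.idxOf ((a :: l).get i)) (a :: l)
          have e1 : r i = ((a :: l).filter
            fun x => ord.idxOf x ≤ ord.idxOf ((a :: l).get i)).length :=
              List.countP_eq_length_filter
          have e2 := List.length_erase_of_mem hmem
          have e3 : ((a :: l).filter
              (fun x => ord.idxOf x ≤ ord.idxOf ((a :: l).get i))).countP
              (fun x => ord.idxOf ((a :: l).get i) < ord.idxOf x) = 0 := by
            rw [List.countP_eq_zero]
            intro x hx
            have := (List.mem_filter.1 hx).2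
            simpa using this
          have e4 := List.length_erase_le (a := (a :: l).get i) (l := BA')
          have e5 := List.countP_le_length
            (p := fun z => decide (ord.idxOf z < ord.idxOf ((a :: l).get i))) (l := BA')
          simp only [List.length_cons] at e0
          simp only [searchPot, List.length_nil]
          rw [e3, e2, ← e1, ← hBA']
          rw [← e1] at e0
          omega
        · have hrle : ∀ i, r i ≤ k := fun i => List.countP_le_length
          -- Choosing and splitting take at most `4 * k + 1`, and the weights of the live forward
          -- vertices are at most `24 * k`. The resulting `28 * k` is the expected drop `112 * k /
          -- 4`.
          have hle : ∀ i : Fin k, (l.length + 1 + 1 + (i.val + 1)) +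
              (2 * k + (112 * (BA'.length + max (k - r i) (r i - 1)) +
              24 * (r i + BA'.length) + (k - r i))) ≤
              112 * BA'.length + 24 * BA'.length + 28 * k + k + 1 +
                112 * max (k - r i) (r i - 1) := by
            intro i
            have := hrle i
            have := i.isLt
            omega
          refine (Finset.sum_le_sum fun i _ => hle i).trans ?_
          rw [Finset.sum_add_distrib, ← Finset.mul_sum]
          simp only [Finset.sum_const, Finset.card_univ, Fintype.card_fin, smul_eq_mul]
          have hr' : 4 * ∑ i : Fin k, max (k - r i) (r i - 1) ≤ 3 * k ^ 2 := hr
          nlinarith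
      rw [h1]
      refine (add_le_add_right h2 _).trans ?_
      rw [add_left_comm]
      gcongr
      norm_cast
      have e1 := List.length_erase_le (a := S.s) (l := S.BA)
      simp only [searchPot, hFA, hFP, List.length_cons, List.countP_nil, List.length_nil]
      rw [← hBA'] at e1 ⊢
      omega
  · have h1 : (updateForward ord S).wp f = 1 + f S := by
      simp [updateForward, Rand.wp_bind, Rand.wp_lift, Rand.wp_pure, hFA]
    rw [h1]
    refine (add_le_add_right (hf S hS (fun h => absurd h hFA) ⟨rfl, rfl, rfl, rfl⟩) _).trans ?_
    rw [add_left_comm]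
    gcongr
    norm_cast
    omega

/-- Mirror image of `wp_updateForward_le`. The hypothesis `hFAP` is passed on when nothing changes;
otherwise `FP` becomes empty. -/
theorem wp_updateBackward_le {ord : List (Fin n)} (hp : Function.Injective fun x => ord.idxOf x)
    {S : SearchState n} (hS : LiveInv (fun x => ord.idxOf x) S)
    (hFAP : S.FA = [] → S.FP = []) (f : SearchState n → ℝ≥0∞)
    (C : ℝ≥0∞)
    (hf : ∀ S', LiveInv (fun x => ord.idxOf x) S' → (S'.FA = [] → S'.FP = []) → (S'.BA = [] → S'.BP = []) → SameVisited S S' →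
      f S' ≤ C + searchPot (fun x => ord.idxOf x) S') :
    (updateBackward ord S).wp f ≤ C + (searchPot (fun x => ord.idxOf x) S + 5 : ℕ) := by
  by_cases hBA : S.BA = []
  · cases hBP : S.BP with
    | nil =>
      have h1 : (updateBackward ord S).wp f =
          ((1 + (S.FP.length + 1) + 1 + 1 : ℕ) : ℝ≥0∞) +
            f { S with FP := [], FA := S.FA.erase S.s } := by
        simp [updateBackward, Rand.wp_bind, Rand.wp_lift, Rand.wp_pure, hBA, hBP]
        ring
      have h2 := hf _ (hS.backward_drop hBA hBP) (fun _ => rfl) (fun _ => hBP) ⟨rfl, rfl, rfl, rfl⟩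
      rw [h1]
      refine (add_le_add_right h2 _).trans ?_
      rw [add_left_comm]
      gcongr
      norm_cast
      simp only [searchPot, hBA, hBP, List.countP_nil, List.length_nil, List.erase_nil]
      have e1 := List.length_erase_le (a := S.s) (l := S.FA)
      have e2 := List.length_erase_le (a := S.s) (l := S.FA.erase S.s)
      have e3 := List.countP_le_length (p := fun z => decide (ord.idxOf S.s < ord.idxOf z))
        (l := S.FA.erase S.s)
      omega
    | cons a l =>
      have h1 : (updateBackward ord S).wp f = ((1 + (S.FP.length + 1) + 1 + 1 : ℕ) : ℝ≥0∞) +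
          (chooseUniform a l).wp (fun s => (split (fun x => lessEq ord s x) (a :: l)).time +
            f { S with FP := [], FA := S.FA.erase S.s, s := s,
                       BA := (a :: l).filter (fun x => ord.idxOf s ≤ ord.idxOf x),
                       BP := (a :: l).filter (fun x => !decide (ord.idxOf s ≤ ord.idxOf x)) }) := by
        simp [updateBackward, Rand.wp_bind, Rand.wp_lift, Rand.wp_pure, hBA, hBP, split_val]
        ring
      have hnd : (a :: l).Nodup := by
        have := hS.nodup_B
        rwa [hBA, hBP, List.nil_append] at this
      set FA' := S.FA.erase S.s with hFA'
      set k := l.length + 1 with hk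
      let r : Fin k → ℕ := fun i =>
        (a :: l).countP fun x => ord.idxOf ((a :: l).get i) ≤ ord.idxOf x
      -- Backward candidates are ranked from the top, that is, in the dual order.
      have hr := sum_rank_le (fun x => OrderDual.toDual (ord.idxOf x)) hp (a :: l) hnd
      have h2 : (chooseUniform a l).wp (fun s => (split (fun x => lessEq ord s x) (a :: l)).time +
            f { S with FP := [], FA := FA', s := s,
                       BA := (a :: l).filter (fun x => ord.idxOf s ≤ ord.idxOf x),
                       BP := (a :: l).filter (fun x => !decide (ord.idxOf s ≤ ord.idxOf x)) }) ≤
          C + (112 * FA'.length + 24 * FA'.length + 112 * k + k + 1: ℕ) := by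
        rw [Rand.wp_chooseUniform]
        refine average_le k _ (by omega) C _ _
          (fun i => 2 * k + (112 * (FA'.length + max (k - r i) (r i - 1)) +
            24 * (r i + FA'.length) + (k - r i))) ?_ ?_
        · intro i
          have ha := hS.backward_choose hBA ((a :: l).get i)
          rw [hBP] at ha
          have hmem : (a :: l).get i ∈ (a :: l).filter
              (fun x => ord.idxOf ((a :: l).get i) ≤ ord.idxOf x) := by
            rw [List.mem_filter]
            exact ⟨List.get_mem _ _, by simp⟩
          have hb := hf _ ha (fun _ => rfl) (fun h0 => by
            simp only [] at h0
            rw [h0] at hmem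
            simp at hmem) ⟨rfl, rfl, rfl, rfl⟩
          refine (add_le_add_right hb _).trans ?_
          rw [add_left_comm]
          gcongr
          norm_cast
          have ht := split_time_le (fun x => lessEq ord ((a :: l).get i) x) 1 (fun _ => le_rfl)
            (a :: l)
          refine Nat.add_le_add ht ?_
          have e0 := filter_le_length (fun x => ord.idxOf ((a :: l).get i) ≤ ord.idxOf x) (a :: l)
          have e1 : r i = ((a :: l).filter
            fun x => ord.idxOf ((a :: l).get i) ≤ ord.idxOf x).length :=
              List.countP_eq_length_filter
          have e2 := List.length_erase_of_mem hmem
          have e3 : ((a :: l).filter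
              (fun x => ord.idxOf ((a :: l).get i) ≤ ord.idxOf x)).countP
              (fun x => ord.idxOf x < ord.idxOf ((a :: l).get i)) = 0 := by
            rw [List.countP_eq_zero]
            intro x hx
            have := (List.mem_filter.1 hx).2
            simpa using this
          have e4 := List.length_erase_le (a := (a :: l).get i) (l := FA')
          have e5 := List.countP_le_length
            (p := fun z => decide (ord.idxOf ((a :: l).get i) < ord.idxOf z)) (l := FA')
          simp only [List.length_cons] at e0
          simp only [searchPot, List.length_nil]
          rw [e3, e2, ← e1, ← hFA']
          rw [← e1] at e0
          omega
        · have hrle : ∀ i, r i ≤ k := fun i => List.countP_le_length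
          have hle : ∀ i : Fin k, (l.length + 1 + 1 + (i.val + 1)) +
              (2 * k + (112 * (FA'.length + max (k - r i) (r i - 1)) +
              24 * (r i + FA'.length) + (k - r i))) ≤
              112 * FA'.length + 24 * FA'.length + 28 * k + k + 1 +
                112 * max (k - r i) (r i - 1) := by
            intro i
            have := hrle i
            have := i.isLt
            omega
          refine (Finset.sum_le_sum fun i _ => hle i).trans ?_
          rw [Finset.sum_add_distrib, ← Finset.mul_sum]
          simp only [Finset.sum_const, Finset.card_univ, Fintype.card_fin, smul_eq_mul]
          have hr' : 4 * ∑ i : Fin k, max (k - r i) (r i - 1) ≤ 3 * k ^ 2 := hr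
          nlinarith
      rw [h1]
      refine (add_le_add_right h2 _).trans ?_
      rw [add_left_comm]
      gcongr
      norm_cast
      have e1 := List.length_erase_le (a := S.s) (l := S.FA)
      simp only [searchPot, hBA, hBP, List.length_cons, List.countP_nil, List.length_nil]
      rw [← hFA'] at e1 ⊢
      omega
  · have h1 : (updateBackward ord S).wp f = 1 + f S := by
      simp [updateBackward, Rand.wp_bind, Rand.wp_lift, Rand.wp_pure, hBA]
    rw [h1]
    refine (add_le_add_right (hf S hS hFAP (fun h => absurd h hBA) ⟨rfl, rfl, rfl, rfl⟩) _).trans ?_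
    rw [add_left_comm]
    gcongr
    norm_cast
    omega

end Live

/-! ### Moves from active to passive -/

section Passive

variable {n : ℕ}

theorem length_erase_erase_le (s u : Fin n) (l : List (Fin n)) :
    ((l.erase u).erase s).length ≤ (l.erase s).length := by
  rw [List.erase_comm]; exact List.length_erase_le

theorem length_erase_cons_le (s x : Fin n) (l : List (Fin n)) :
    ((x :: l).erase s).length ≤ (l.erase s).length + 1 := by
  rw [List.erase_cons]
  split
  · rw [List.length_erase]; split <;> omega
  · simp

theorem length_erase_add_one {u : Fin n} {l : List (Fin n)} (h : u ∈ l) :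
    (l.erase u).length + 1 = l.length := by
  rw [List.length_erase_of_mem h]
  have := List.length_pos_of_mem h
  omega

theorem countP_erase_add_one {u : Fin n} {l : List (Fin n)} {q : Fin n → Bool} (h : u ∈ l)
    (hq : q u = true) : (l.erase u).countP q + 1 = l.countP q := by
  rw [(List.perm_cons_erase h).countP_eq q, List.countP_cons_of_pos hq]

/-- As `u` lies after `s`, it was already counted as a survivor, so the main term does not grow. The
drop is the difference `24 - 1` of the weights of an active and a passive vertex. -/
theorem LiveInv.passive_forward {p : Fin n → ℕ} {S : SearchState n} (h : LiveInv p S)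
    {u : Fin n} (hu : u ∈ S.FA) (hs : p S.s < p u) :
    LiveInv p { S with FA := S.FA.erase u, FP := u :: S.FP } ∧
    searchPot p { S with FA := S.FA.erase u, FP := u :: S.FP } + 23 ≤ searchPot p S := by
  obtain ⟨h1, h2, h3, h4, h5, h6, h7⟩ := h
  have hmem : ∀ x, (x ∈ S.FA.erase u ∨ x ∈ u :: S.FP) ↔ (x ∈ S.FA ∨ x ∈ S.FP) := by
    intro x
    by_cases hx : x = u
    · subst hx; simp [hu]
    · simp [List.mem_erase_of_ne hx, hx]
  refine ⟨⟨?_, h2, ?_, h4, ?_, h6, ?_⟩, ?_⟩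
  · have hp : (S.FA.erase u ++ u :: S.FP).Perm (S.FA ++ S.FP) :=
      List.perm_middle.trans ((List.perm_cons_erase hu).symm.append_right S.FP)
    exact hp.nodup_iff.2 h1
  · intro x hx
    rcases List.mem_cons.1 hx with rfl | hx
    · exact hs
    · exact h3 x hx
  · intro x hx; exact h5 x ((hmem x).1 hx)
  · intro x hx hox z hz hiz
    rcases h7 x hx hox z hz hiz with h | ⟨ha, hb⟩
    · exact Or.inl h
    · exact Or.inr ⟨(hmem x).2 ha, hb⟩
  · have e1 := length_erase_add_one hu
    have e2 := countP_erase_add_one (q := fun x => p S.s < p x) hu (by simpa using hs)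
    have e3 := length_erase_erase_le S.s u S.FA
    simp only [searchPot, List.length_cons]
    omega

theorem LiveInv.passive_backward {p : Fin n → ℕ} {S : SearchState n} (h : LiveInv p S)
    {z : Fin n} (hz : z ∈ S.BA) (hs : p z < p S.s) :
    LiveInv p { S with BA := S.BA.erase z, BP := z :: S.BP } ∧
    searchPot p { S with BA := S.BA.erase z, BP := z :: S.BP } + 23 ≤ searchPot p S := by
  obtain ⟨h1, h2, h3, h4, h5, h6, h7⟩ := h
  have hmem : ∀ x, (x ∈ S.BA.erase z ∨ x ∈ z :: S.BP) ↔ (x ∈ S.BA ∨ x ∈ S.BP) := by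
    intro x
    by_cases hx : x = z
    · subst hx; simp [hz]
    · simp [List.mem_erase_of_ne hx, hx]
  refine ⟨⟨h1, ?_, h3, ?_, h5, ?_, ?_⟩, ?_⟩
  · have hp : (S.BA.erase z ++ z :: S.BP).Perm (S.BA ++ S.BP) :=
      List.perm_middle.trans ((List.perm_cons_erase hz).symm.append_right S.BP)
    exact hp.nodup_iff.2 h2
  · intro x hx
    rcases List.mem_cons.1 hx with rfl | hx
    · exact hs
    · exact h4 x hx
  · intro x hx; exact h6 x ((hmem x).1 hx)
  · intro x hx hox y hy hiy
    rcases h7 x hx hox y hy hiy with h | ⟨ha, hb⟩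
    · exact Or.inl h
    · exact Or.inr ⟨ha, (hmem y).2 hb⟩
  · have e1 := length_erase_add_one hz
    have e2 := countP_erase_add_one (q := fun x => p x < p S.s) hz (by simpa using hs)
    have e3 := length_erase_erase_le S.s z S.BA
    simp only [searchPot, List.length_cons]
    omega

theorem makePassive_spec {ord : List (Fin n)} {S : SearchState n}
    (h : LiveInv (fun x => ord.idxOf x) S) {u z : Fin n} (hu : u ∈ S.FA) (hz : z ∈ S.BA)
    (hlt : ord.idxOf z < ord.idxOf u) :
    LiveInv (fun x => ord.idxOf x) (makePassive ord u z S).val ∧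
    SameVisited S (makePassive ord u z S).val ∧
    (makePassive ord u z S).time ≤ 6 ∧
    searchPot (fun x => ord.idxOf x) (makePassive ord u z S).val + 23 ≤
      searchPot (fun x => ord.idxOf x) S := by
  by_cases h1 : ord.idxOf S.s < ord.idxOf u
  · obtain ⟨a1, a2⟩ := h.passive_forward hu h1
    by_cases h2 : ord.idxOf z < ord.idxOf S.s
    · obtain ⟨b1, b2⟩ := a1.passive_backward (z := z) hz h2
      have key : makePassive ord u z S =
          ⟨{ S with FA := S.FA.erase u, FP := u :: S.FP,
                    BA := S.BA.erase z, BP := z :: S.BP }, 6⟩ := by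
        change Timed.mk _ _ = _
        simp [h1, h2]
      rw [key]
      exact ⟨b1, ⟨rfl, rfl, rfl, rfl⟩, by simp, by simp only at b2 ⊢; omega⟩
    · have key : makePassive ord u z S =
          ⟨{ S with FA := S.FA.erase u, FP := u :: S.FP }, 4⟩ := by
        change Timed.mk _ _ = _
        simp [h1, h2]
      rw [key]
      exact ⟨a1, ⟨rfl, rfl, rfl, rfl⟩, by simp, a2⟩
  -- From `z < u ≤ s`: at least one of the two vertices always becomes passive.
  · have h2 : ord.idxOf z < ord.idxOf S.s := by omega
    obtain ⟨b1, b2⟩ := h.passive_backward hz h2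
    have key : makePassive ord u z S =
        ⟨{ S with BA := S.BA.erase z, BP := z :: S.BP }, 4⟩ := by
      change Timed.mk _ _ = _
      simp [h1, h2]
    rw [key]
    exact ⟨b1, ⟨rfl, rfl, rfl, rfl⟩, by simp, b2⟩

end Passive

/-! ### Traversed arcs -/

section Trace

variable {n : ℕ}

/-- The graph and its order are as they should be between arc additions. -/
structure GoodData (G : Data n) : Prop where
  nodup : G.order.Nodup
  complete : ∀ x, x ∈ G.order
  mem_inList : ∀ a b, a ∈ G.inList b ↔ b ∈ G.outList a
  nodup_out : ∀ a, (G.outList a).Nodup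
  nodup_in : ∀ a, (G.inList a).Nodup
  topological : ∀ a, ∀ b ∈ G.outList a, G.order.idxOf a < G.order.idxOf b

theorem GoodData.injective {G : Data n} (h : GoodData G) :
    Function.Injective fun x => G.order.idxOf x :=
  fun x _ hxy => (List.idxOf_inj (h.complete x)).1 hxy

/-- One direction of a search from `root`: `F` is the list of visited vertices, `out` are the
pointers into the lists `adj`, and `T` lists the traversed arcs. -/
structure HalfTrace (adj : Fin n → List (Fin n)) (root : Fin n) (F : List (Fin n))
    (out : Fin n → List (Fin n)) (T : List (Fin n × Fin n)) : Prop where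
  nodup : F.Nodup
  root_mem : root ∈ F
  reach : ∀ x ∈ F, Relation.ReflTransGen (fun a b => b ∈ adj a) root x
  suffix : ∀ x ∈ F, out x <:+ adj x
  nodup_trace : T.Nodup
  traced : ∀ e ∈ T, e.1 ∈ F ∧ e.2 ∈ F ∧ e.2 ∈ adj e.1 ∧ e.2 ∉ out e.1
  cover : ∀ x ∈ F, ∀ y ∈ adj x, y ∉ out x → (x, y) ∈ T
  -- Every visited vertex other than the root was discovered by an arc of its own.
  length_le : F.length ≤ T.length + 1

/-- The arc is new in the trace because its head was still in the untraversed part of `adj u`;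
absence of repetitions in `adj u` keeps it out of the remaining part. -/
theorem HalfTrace.step {adj : Fin n → List (Fin n)} (hadj : ∀ x, (adj x).Nodup) {root : Fin n}
    {F : List (Fin n)} {out : Fin n → List (Fin n)} {T : List (Fin n × Fin n)}
    (h : HalfTrace adj root F out T) {u x : Fin n} {xs : List (Fin n)} (hu : u ∈ F)
    (hout : out u = x :: xs) :
    HalfTrace adj root (if x ∈ F then F else x :: F)
      (if x ∈ F then Function.update out u xs
        else Function.update (Function.update out u xs) x (adj x)) ((u, x) :: T) := by
  have hsu := h.suffix u hu
  rw [hout] at hsu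
  have hxadj : x ∈ adj u := hsu.subset (by simp)
  have hnd : (x :: xs).Nodup := hsu.sublist.nodup (hadj u)
  have hxxs : x ∉ xs := (List.nodup_cons.1 hnd).1
  have hnew : (u, x) ∉ T := fun hT => (h.traced _ hT).2.2.2 (by simp [hout])
  have hsuf : xs <:+ adj u := (List.suffix_cons x xs).trans hsu
  by_cases hx : x ∈ F
  · rw [if_pos hx, if_pos hx]
    refine ⟨h.nodup, h.root_mem, h.reach, ?_, List.nodup_cons.2 ⟨hnew, h.nodup_trace⟩, ?_, ?_, ?_⟩
    · intro a ha
      by_cases hau : a = u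
      · subst hau; simpa using hsuf
      · simpa [hau] using h.suffix a ha
    · intro e he
      rcases List.mem_cons.1 he with rfl | he
      · exact ⟨hu, hx, hxadj, by simpa using hxxs⟩
      · obtain ⟨a1, a2, a3, a4⟩ := h.traced e he
        refine ⟨a1, a2, a3, ?_⟩
        by_cases hau : e.1 = u
        · rw [hau, Function.update_self]
          rw [hau, hout] at a4
          exact fun hh => a4 (by simp [hh])
        · rwa [Function.update_of_ne hau]
    · intro a ha y hy hya
      by_cases hau : a = u
      · subst hau
        rw [Function.update_self] at hya
        by_cases hyx : y = x
        · subst hyx; simp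
        · exact List.mem_cons_of_mem _ (h.cover a ha y hy (by simp [hout, hyx, hya]))
      · rw [Function.update_of_ne hau] at hya
        exact List.mem_cons_of_mem _ (h.cover a ha y hy hya)
    · have := h.length_le
      simp only [List.length_cons]; omega
  · rw [if_neg hx, if_neg hx]
    have hux : u ≠ x := fun he => hx (he ▸ hu)
    refine ⟨List.nodup_cons.2 ⟨hx, h.nodup⟩, List.mem_cons_of_mem _ h.root_mem, ?_, ?_,
      List.nodup_cons.2 ⟨hnew, h.nodup_trace⟩, ?_, ?_, ?_⟩
    · intro a ha
      rcases List.mem_cons.1 ha with rfl | ha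
      · exact (h.reach u hu).tail hxadj
      · exact h.reach a ha
    · intro a ha
      rcases List.mem_cons.1 ha with rfl | ha
      · simp
      · have hax : a ≠ x := fun he => hx (he ▸ ha)
        rw [Function.update_of_ne hax]
        by_cases hau : a = u
        · subst hau; simpa using hsuf
        · simpa [hau] using h.suffix a ha
    · intro e he
      rcases List.mem_cons.1 he with rfl | he
      · refine ⟨List.mem_cons_of_mem _ hu, by simp, hxadj, ?_⟩
        rw [Function.update_of_ne hux, Function.update_self]
        exact hxxs
      · obtain ⟨a1, a2, a3, a4⟩ := h.traced e he
        refine ⟨List.mem_cons_of_mem _ a1, List.mem_cons_of_mem _ a2, a3, ?_⟩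
        have hax : e.1 ≠ x := fun he => hx (he ▸ a1)
        rw [Function.update_of_ne hax]
        by_cases hau : e.1 = u
        · rw [hau, Function.update_self]
          rw [hau, hout] at a4
          exact fun hh => a4 (by simp [hh])
        · rwa [Function.update_of_ne hau]
    · intro a ha y hy hya
      rcases List.mem_cons.1 ha with rfl | ha
      · rw [Function.update_self] at hya
        exact absurd hy hya
      · have hax : a ≠ x := fun he => hx (he ▸ ha)
        rw [Function.update_of_ne hax] at hya
        by_cases hau : a = u
        · subst hau
          rw [Function.update_self] at hya
          by_cases hyx : y = x
          · subst hyx; simp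
          · exact List.mem_cons_of_mem _ (h.cover a ha y hy (by simp [hout, hyx, hya]))
        · rw [Function.update_of_ne hau] at hya
          exact List.mem_cons_of_mem _ (h.cover a ha y hy hya)
    · have := h.length_le
      simp only [List.length_cons]; omega

/-- The part of the invariant of a search that concerns the visited vertices and the list `T` of
the pairs of arcs traversed so far. -/
structure TraceInv (G : Data n) (v w : Fin n) (S : SearchState n)
    (T : List ((Fin n × Fin n) × (Fin n × Fin n))) : Prop where
  forward : HalfTrace G.outList w S.F S.out (T.map Prod.fst)
  -- Read along the incoming lists, an arc `(y, z)` leads from `z` to `y`; hence the swap.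
  backward : HalfTrace G.inList v S.B S.inn (T.map fun e => e.2.swap)
  disjoint : ∀ x ∈ S.F, x ∉ S.B
  compatible : ∀ e ∈ T, G.order.idxOf e.1.1 < G.order.idxOf e.2.2

theorem TraceInv.congr {G : Data n} {v w : Fin n} {S S' : SearchState n}
    {T : List ((Fin n × Fin n) × (Fin n × Fin n))} (h : TraceInv G v w S T)
    (hS : SameVisited S S') : TraceInv G v w S' T := by
  obtain ⟨h1, h2, h3, h4⟩ := hS
  obtain ⟨a1, a2, a3, a4⟩ := h
  exact ⟨by rwa [h1, h3], by rwa [h2, h4], by rwa [h1, h2], a4⟩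

theorem visitForward_val (G : Data n) (x : Fin n) (S : SearchState n) :
    (visitForward G x S).val = if x ∈ S.F then S else
      { S with F := x :: S.F, FA := if G.outList x = [] then S.FA else x :: S.FA,
               out := Function.update S.out x (G.outList x) } := by
  by_cases h : x ∈ S.F <;> by_cases h2 : G.outList x = [] <;> simp [visitForward, h, h2]

theorem visitForward_time (G : Data n) (x : Fin n) (S : SearchState n) :
    (visitForward G x S).time ≤ 4 := by
  by_cases h : x ∈ S.F <;> by_cases h2 : G.outList x = [] <;> simp [visitForward, h, h2]

theorem visitBackward_val (G : Data n) (y : Fin n) (S : SearchState n) :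
    (visitBackward G y S).val = if y ∈ S.B then S else
      { S with B := y :: S.B, BA := if G.inList y = [] then S.BA else y :: S.BA,
               inn := Function.update S.inn y (G.inList y) } := by
  by_cases h : y ∈ S.B <;> by_cases h2 : G.inList y = [] <;> simp [visitBackward, h, h2]

theorem visitBackward_time (G : Data n) (y : Fin n) (S : SearchState n) :
    (visitBackward G y S).time ≤ 4 := by
  by_cases h : y ∈ S.B <;> by_cases h2 : G.inList y = [] <;> simp [visitBackward, h, h2]

/-- The pointers at `u` and `z` are advanced to `xs` and `ys`. -/
def advance (u z : Fin n) (xs ys : List (Fin n)) (S : SearchState n) : SearchState n :=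
  { S with out := Function.update S.out u xs, inn := Function.update S.inn z ys,
           FA := if xs = [] then S.FA.erase u else S.FA,
           BA := if ys = [] then S.BA.erase z else S.BA }

theorem searchStep_cases (G : Data n) {u z x y : Fin n} {xs ys : List (Fin n)} {S : SearchState n}
    (hx : S.out u = x :: xs) (hy : S.inn z = y :: ys) :
    (searchStep G u z S).time ≤ 16 ∧
    ((∃ a, (searchStep G u z S).val = .inl a) ∨ (x ∉ S.B ∧ y ∉ S.F ∧ x ≠ y ∧
      (searchStep G u z S).val =
        .inr (visitBackward G y (visitForward G x (advance u z xs ys S)).val).val)) := by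
  have t1 := visitForward_time G x (advance u z xs ys S)
  have t2 := visitBackward_time G y (visitForward G x (advance u z xs ys S)).val
  by_cases h1 : xs = [] <;> by_cases h2 : ys = [] <;> by_cases h3 : x ∈ S.B <;>
    by_cases h4 : y ∈ S.F <;> by_cases h5 : y = x <;>
    simp only [advance, h1, h2, if_true, if_false] at t1 t2 <;>
    simp [searchStep, hx, hy, h1, h2, h3, h4, h5, advance] <;> grind

theorem LiveInv.advance {p : Fin n → ℕ} {S : SearchState n} (h : LiveInv p S) {u z x y : Fin n}
    {xs ys : List (Fin n)} (hu : u ∈ S.FA) (hz : z ∈ S.BA)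
    (hx : S.out u = x :: xs) (hy : S.inn z = y :: ys) :
    LiveInv p (advance u z xs ys S) ∧
    (∀ a ∈ S.F, Function.update S.out u xs a ≠ [] →
      p z < p a ∨ a ∈ (SoftThreshold.advance u z xs ys S).FA ∨ a ∈ S.FP) ∧
    (∀ b ∈ S.B, Function.update S.inn z ys b ≠ [] →
      p b < p u ∨ b ∈ (SoftThreshold.advance u z xs ys S).BA ∨ b ∈ S.BP) ∧
    searchPot p (SoftThreshold.advance u z xs ys S) ≤ searchPot p S := by
  obtain ⟨h1, h2, h3, h4, h5, h6, h7⟩ := h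
  have nF := List.nodup_append.1 h1
  have nB := List.nodup_append.1 h2
  have huP : u ∉ S.FP := fun hh => nF.2.2 u hu u hh rfl
  have hzP : z ∉ S.BP := fun hh => nB.2.2 z hz z hh rfl
  have mF : ∀ a, Function.update S.out u xs a ≠ [] →
      (a ∈ (SoftThreshold.advance u z xs ys S).FA ↔ a ∈ S.FA) ∧ S.out a ≠ [] := by
    intro a ha
    by_cases hau : a = u
    · subst hau
      rw [Function.update_self] at ha
      simp [SoftThreshold.advance, ha, hx]
    · rw [Function.update_of_ne hau] at ha
      refine ⟨?_, ha⟩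
      by_cases hxs : xs = [] <;> simp [SoftThreshold.advance, hxs, List.mem_erase_of_ne hau]
  have mB : ∀ a, Function.update S.inn z ys a ≠ [] →
      (a ∈ (SoftThreshold.advance u z xs ys S).BA ↔ a ∈ S.BA) ∧ S.inn a ≠ [] := by
    intro a ha
    by_cases hau : a = z
    · subst hau
      rw [Function.update_self] at ha
      simp [SoftThreshold.advance, ha, hy]
    · rw [Function.update_of_ne hau] at ha
      refine ⟨?_, ha⟩
      by_cases hxs : ys = [] <;> simp [SoftThreshold.advance, hxs, List.mem_erase_of_ne hau]
  have sF : (SoftThreshold.advance u z xs ys S).FA.Sublist S.FA := by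
    simp only [SoftThreshold.advance]
    split
    · exact List.erase_sublist
    · exact List.Sublist.refl _
  have sB : (SoftThreshold.advance u z xs ys S).BA.Sublist S.BA := by
    simp only [SoftThreshold.advance]
    split
    · exact List.erase_sublist
    · exact List.Sublist.refl _
  refine ⟨⟨?_, ?_, h3, h4, ?_, ?_, ?_⟩, ?_, ?_, ?_⟩
  · exact (sF.append (List.Sublist.refl S.FP)).nodup h1
  · exact (sB.append (List.Sublist.refl S.BP)).nodup h2
  · intro a ha
    have ha' : a ∈ S.FA ∨ a ∈ S.FP := ha.imp (fun h => sF.subset h) id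
    refine ⟨(h5 a ha').1, ?_⟩
    change Function.update S.out u xs a ≠ []
    by_cases hau : a = u
    · subst hau
      rw [Function.update_self]
      intro hxs
      simp [SoftThreshold.advance, hxs, huP, nF.1.mem_erase_iff] at ha
    · rw [Function.update_of_ne hau]
      exact (h5 a ha').2
  · intro a ha
    have ha' : a ∈ S.BA ∨ a ∈ S.BP := ha.imp (fun h => sB.subset h) id
    refine ⟨(h6 a ha').1, ?_⟩
    change Function.update S.inn z ys a ≠ []
    by_cases hau : a = z
    · subst hau
      rw [Function.update_self]
      intro hxs
      simp [SoftThreshold.advance, hxs, hzP, nB.1.mem_erase_iff] at ha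
    · rw [Function.update_of_ne hau]
      exact (h6 a ha').2
  · intro a ha hoa b hb hib
    obtain ⟨m1, m2⟩ := mF a hoa
    obtain ⟨m3, m4⟩ := mB b hib
    rw [m1, m3]
    exact h7 a ha m2 b hb m4
  · intro a ha hoa
    obtain ⟨m1, m2⟩ := mF a hoa
    rw [m1]
    rcases h7 a ha m2 z (h6 z (Or.inl hz)).1 (h6 z (Or.inl hz)).2 with h | h
    · exact Or.inl h
    · exact Or.inr h.1
  · intro b hb hib
    obtain ⟨m1, m2⟩ := mB b hib
    rw [m1]
    rcases h7 u (h5 u (Or.inl hu)).1 (h5 u (Or.inl hu)).2 b hb m2 with h | h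
    · exact Or.inl h
    · exact Or.inr h.2
  · have e1 := sF.countP_le (p := fun x => decide (p S.s < p x))
    have e2 := sB.countP_le (p := fun x => decide (p x < p S.s))
    have e3 := (sF.erase S.s).length_le
    have e4 := (sB.erase S.s).length_le
    have e5 := sF.length_le
    have e6 := sB.length_le
    have e7 : (SoftThreshold.advance u z xs ys S).s = S.s := rfl
    have e8 : (SoftThreshold.advance u z xs ys S).FP = S.FP := rfl
    have e9 : (SoftThreshold.advance u z xs ys S).BP = S.BP := rfl
    simp only [searchPot, e7, e8, e9]
    omega

/-- One new active vertex raises each argument of the maximum by at most one; `136 = 112 + 24`. -/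
theorem LiveInv.visitForward {p : Fin n → ℕ} {S : SearchState n} (h : LiveInv p S) (G : Data n)
    {x : Fin n} (hx : ∀ b ∈ S.B, S.inn b ≠ [] → p b < p x ∨ b ∈ S.BA ∨ b ∈ S.BP) :
    LiveInv p (visitForward G x S).val ∧
    searchPot p (SoftThreshold.visitForward G x S).val ≤ searchPot p S + 136 := by
  rw [visitForward_val]
  by_cases hxF : x ∈ S.F
  · rw [if_pos hxF]
    exact ⟨h, by omega⟩
  · rw [if_neg hxF]
    obtain ⟨h1, h2, h3, h4, h5, h6, h7⟩ := h
    have hxA : x ∉ S.FA := fun hh => hxF (h5 x (Or.inl hh)).1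
    have hxP : x ∉ S.FP := fun hh => hxF (h5 x (Or.inr hh)).1
    have hne : ∀ a ∈ S.F, a ≠ x := fun a ha he => hxF (he ▸ ha)
    by_cases hnull : G.outList x = []
    · simp only [hnull, if_true]
      refine ⟨⟨h1, h2, h3, h4, ?_, h6, ?_⟩, by simp [searchPot]⟩
      · intro a ha
        obtain ⟨b1, b2⟩ := h5 a ha
        exact ⟨List.mem_cons_of_mem _ b1, by simpa [hne a b1] using b2⟩
      · intro a ha hoa b hb hib
        rcases List.mem_cons.1 ha with rfl | ha
        · simp at hoa
        · simp only [Function.update_of_ne (hne a ha)] at hoa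
          exact h7 a ha hoa b hb hib
    · simp only [hnull, if_false]
      refine ⟨⟨?_, h2, h3, h4, ?_, h6, ?_⟩, ?_⟩
      · rw [List.cons_append, List.nodup_cons]
        exact ⟨by simp [hxA, hxP], h1⟩
      · intro a ha
        by_cases hax : a = x
        · subst hax; simp [hnull]
        · have ha' : a ∈ S.FA ∨ a ∈ S.FP := by simpa [hax] using ha
          simpa [hax] using h5 a ha'
      · intro a ha hoa b hb hib
        rcases List.mem_cons.1 ha with rfl | ha
        · rcases hx b hb hib with h | h
          · exact Or.inl h
          · exact Or.inr ⟨Or.inl (by simp), h⟩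
        · simp only [Function.update_of_ne (hne a ha)] at hoa
          rcases h7 a ha hoa b hb hib with h | ⟨h, h'⟩
          · exact Or.inl h
          · exact Or.inr ⟨h.imp (List.mem_cons_of_mem _) id, h'⟩
      · have e1 := length_erase_cons_le S.s x S.FA
        have e2 : (x :: S.FA).countP (fun a => p S.s < p a) ≤
            S.FA.countP (fun a => p S.s < p a) + 1 := by
          rw [List.countP_cons]; split <;> omega
        simp only [searchPot, List.length_cons]
        omega

theorem LiveInv.visitBackward {p : Fin n → ℕ} {S : SearchState n} (h : LiveInv p S) (G : Data n)
    {x : Fin n} (hx : ∀ b ∈ S.F, S.out b ≠ [] → p x < p b ∨ b ∈ S.FA ∨ b ∈ S.FP) :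
    LiveInv p (visitBackward G x S).val ∧
    searchPot p (SoftThreshold.visitBackward G x S).val ≤ searchPot p S + 136 := by
  rw [visitBackward_val]
  by_cases hxF : x ∈ S.B
  · rw [if_pos hxF]
    exact ⟨h, by omega⟩
  · rw [if_neg hxF]
    obtain ⟨h1, h2, h3, h4, h5, h6, h7⟩ := h
    have hxA : x ∉ S.BA := fun hh => hxF (h6 x (Or.inl hh)).1
    have hxP : x ∉ S.BP := fun hh => hxF (h6 x (Or.inr hh)).1
    have hne : ∀ a ∈ S.B, a ≠ x := fun a ha he => hxF (he ▸ ha)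
    by_cases hnull : G.inList x = []
    · simp only [hnull, if_true]
      refine ⟨⟨h1, h2, h3, h4, h5, ?_, ?_⟩, by simp [searchPot]⟩
      · intro a ha
        obtain ⟨b1, b2⟩ := h6 a ha
        exact ⟨List.mem_cons_of_mem _ b1, by simpa [hne a b1] using b2⟩
      · intro b hb hib a ha hoa
        rcases List.mem_cons.1 ha with rfl | ha
        · simp at hoa
        · simp only [Function.update_of_ne (hne a ha)] at hoa
          exact h7 b hb hib a ha hoa
    · simp only [hnull, if_false]
      refine ⟨⟨h1, ?_, h3, h4, h5, ?_, ?_⟩, ?_⟩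
      · rw [List.cons_append, List.nodup_cons]
        exact ⟨by simp [hxA, hxP], h2⟩
      · intro a ha
        by_cases hax : a = x
        · subst hax; simp [hnull]
        · have ha' : a ∈ S.BA ∨ a ∈ S.BP := by simpa [hax] using ha
          simpa [hax] using h6 a ha'
      · intro b hb hib a ha hoa
        rcases List.mem_cons.1 ha with rfl | ha
        · rcases hx b hb hib with h | h
          · exact Or.inl h
          · exact Or.inr ⟨h, Or.inl (by simp)⟩
        · simp only [Function.update_of_ne (hne a ha)] at hoa
          rcases h7 b hb hib a ha hoa with h | ⟨h', h⟩
          · exact Or.inl h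
          · exact Or.inr ⟨h', h.imp (List.mem_cons_of_mem _) id⟩
      · have e1 := length_erase_cons_le S.s x S.BA
        have e2 : (x :: S.BA).countP (fun a => p a < p S.s) ≤
            S.BA.countP (fun a => p a < p S.s) + 1 := by
          rw [List.countP_cons]; split <;> omega
        simp only [searchPot, List.length_cons]
        omega

/-- Topological order gives `u < x` and `y < z`, so the frontier relations at `u` and `z` pass to
the new vertices. The two visits together cost at most `2 * 136 = 272` of potential. -/
theorem searchStep_spec {G : Data n} (hG : GoodData G) {v w : Fin n} {S : SearchState n}
    {T : List ((Fin n × Fin n) × (Fin n × Fin n))}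
    (hL : LiveInv (fun x => G.order.idxOf x) S) (hT : TraceInv G v w S T)
    {u z : Fin n} (hu : u ∈ S.FA) (hz : z ∈ S.BA) (huz : G.order.idxOf u < G.order.idxOf z) :
    (searchStep G u z S).time ≤ 16 ∧
    ((∃ a, (searchStep G u z S).val = .inl a) ∨
      ∃ S' e, (searchStep G u z S).val = .inr S' ∧ LiveInv (fun x => G.order.idxOf x) S' ∧
        TraceInv G v w S' (e :: T) ∧
        searchPot (fun x => G.order.idxOf x) S' ≤
          searchPot (fun x => G.order.idxOf x) S + 272) := by
  obtain ⟨huF, hou⟩ := hL.live_F u (Or.inl hu)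
  obtain ⟨hzB, hiz⟩ := hL.live_B z (Or.inl hz)
  obtain ⟨x, xs, hx⟩ := List.exists_cons_of_ne_nil hou
  obtain ⟨y, ys, hy⟩ := List.exists_cons_of_ne_nil hiz
  obtain ⟨htime, hval⟩ := searchStep_cases G hx hy
  refine ⟨htime, hval.imp id ?_⟩
  rintro ⟨hxB, hyF, hxy, hval⟩
  have hux : G.order.idxOf u < G.order.idxOf x := by
    apply hG.topological
    apply (hT.forward.suffix u huF).subset
    simp [hx]
  have hyz : G.order.idxOf y < G.order.idxOf z := by
    apply hG.topological
    rw [← hG.mem_inList]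
    apply (hT.backward.suffix z hzB).subset
    simp [hy]
  obtain ⟨a1, a2, a3, a4⟩ := hL.advance hu hz hx hy
  obtain ⟨b1, b2⟩ := a1.visitForward G (x := x) (by
    intro b hb hib
    exact (a3 b hb hib).imp (fun h => h.trans hux) id)
  obtain ⟨c1, c2⟩ := b1.visitBackward G (x := y) (by
    intro b
    rw [visitForward_val]
    by_cases hxF : x ∈ S.F
    · rw [if_pos (by exact hxF)]
      intro hb hob
      exact (a2 b hb hob).imp (fun h => hyz.trans h) id
    · rw [if_neg (by exact hxF)]
      intro hb hob
      rcases List.mem_cons.1 hb with rfl | hb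
      · simp only [Function.update_self] at hob
        simp [hob]
      · have hne : b ≠ x := fun he => hxF (he ▸ hb)
        simp only [Function.update_of_ne hne] at hob
        rcases a2 b hb hob with h | h | h
        · exact Or.inl (hyz.trans h)
        · right; left
          simp only
          split
          · exact h
          · exact List.mem_cons_of_mem _ h
        · exact Or.inr (Or.inr h))
  refine ⟨_, ((u, x), (y, z)), hval, c1, ?_, by omega⟩
  have f1 := hT.forward.step hG.nodup_out huF hx
  have f2 := hT.backward.step hG.nodup_in hzB hy
  have hF : (visitBackward G y (visitForward G x (advance u z xs ys S)).val).val.F =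
      if x ∈ S.F then S.F else x :: S.F := by
    rw [visitBackward_val, visitForward_val]
    by_cases hxF : x ∈ S.F <;> by_cases hyB : y ∈ S.B <;> simp [advance, hxF, hyB]
  have hB : (visitBackward G y (visitForward G x (advance u z xs ys S)).val).val.B =
      if y ∈ S.B then S.B else y :: S.B := by
    rw [visitBackward_val, visitForward_val]
    by_cases hxF : x ∈ S.F <;> by_cases hyB : y ∈ S.B <;> simp [advance, hxF, hyB]
  have ho : (visitBackward G y (visitForward G x (advance u z xs ys S)).val).val.out =
      if x ∈ S.F then Function.update S.out u xs
        else Function.update (Function.update S.out u xs) x (G.outList x) := by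
    rw [visitBackward_val, visitForward_val]
    by_cases hxF : x ∈ S.F <;> by_cases hyB : y ∈ S.B <;> simp [advance, hxF, hyB]
  have hi : (visitBackward G y (visitForward G x (advance u z xs ys S)).val).val.inn =
      if y ∈ S.B then Function.update S.inn z ys
        else Function.update (Function.update S.inn z ys) y (G.inList y) := by
    rw [visitBackward_val, visitForward_val]
    by_cases hxF : x ∈ S.F <;> by_cases hyB : y ∈ S.B <;> simp [advance, hxF, hyB]
  refine ⟨?_, ?_, ?_, ?_⟩
  · rw [hF, ho]; exact f1
  · rw [hB, hi]; exact f2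
  · rw [hF, hB]
    intro a ha hb
    have ha' : a = x ∨ a ∈ S.F := by
      split at ha
      · exact Or.inr ha
      · exact List.mem_cons.1 ha
    have hb' : a = y ∨ a ∈ S.B := by
      split at hb
      · exact Or.inr hb
      · exact List.mem_cons.1 hb
    rcases ha' with rfl | ha'
    · exact hb'.elim hxy hxB
    · exact hb'.elim (fun h => hyF (h ▸ ha')) (hT.disjoint a ha')
  · intro e he
    rcases List.mem_cons.1 he with rfl | he
    · exact huz
    · exact hT.compatible e he

end Trace

/-! ### Related pairs of arcs -/

section Related

variable {n : ℕ}

/-- The arcs of the graph. -/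
def arcSet (G : Data n) : Finset (Fin n × Fin n) :=
  Finset.univ.filter fun e => e.2 ∈ G.outList e.1

open Classical in
/-- The pairs of arcs such that a path leads from the first arc to the second. -/
noncomputable def relatedPairs (G : Data n) : Finset ((Fin n × Fin n) × (Fin n × Fin n)) :=
  Finset.univ.filter fun p => p.1 ∈ arcSet G ∧ p.2 ∈ arcSet G ∧
    Relation.ReflTransGen (fun a b => b ∈ G.outList a) p.1.2 p.2.1

theorem mem_arcSet {G : Data n} {e : Fin n × Fin n} : e ∈ arcSet G ↔ e.2 ∈ G.outList e.1 := by
  simp [arcSet]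

theorem mem_relatedPairs {G : Data n} {p : (Fin n × Fin n) × (Fin n × Fin n)} :
    p ∈ relatedPairs G ↔ p.1 ∈ arcSet G ∧ p.2 ∈ arcSet G ∧
      Relation.ReflTransGen (fun a b => b ∈ G.outList a) p.1.2 p.2.1 := by
  simp [relatedPairs]

theorem card_relatedPairs_le (G : Data n) : (relatedPairs G).card ≤ (arcSet G).card ^ 2 := by
  have : relatedPairs G ⊆ arcSet G ×ˢ arcSet G := by
    intro p hp
    rw [mem_relatedPairs] at hp
    exact Finset.mem_product.2 ⟨hp.1, hp.2.1⟩
  calc _ ≤ _ := Finset.card_le_card this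
    _ = _ := by rw [Finset.card_product, sq]

theorem GoodData.idxOf_le_of_reach {G : Data n} (hG : GoodData G) {a b : Fin n}
    (h : Relation.ReflTransGen (fun a b => b ∈ G.outList a) a b) :
    G.order.idxOf a ≤ G.order.idxOf b := by
  induction h with
  | refl => exact le_rfl
  | tail _ h ih => exact ih.trans (hG.topological _ _ h).le

theorem TraceInv.reach_backward {G : Data n} (hG : GoodData G) {v w : Fin n} {S : SearchState n}
    {T : List ((Fin n × Fin n) × (Fin n × Fin n))} (hT : TraceInv G v w S T) {z : Fin n}
    (hz : z ∈ S.B) : Relation.ReflTransGen (fun a b => b ∈ G.outList a) z v := by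
  have := (hT.backward.reach z hz).swap
  exact Relation.ReflTransGen.mono (fun a b h => (hG.mem_inList _ _).1 h) _ _ this

/-- Within one search the forward arcs are distinct. -/
theorem TraceInv.length_le {G : Data n} {v w : Fin n} {S : SearchState n}
    {T : List ((Fin n × Fin n) × (Fin n × Fin n))} (hT : TraceInv G v w S T) :
    T.length ≤ (arcSet G).card := by
  have h1 : (T.map Prod.fst).toFinset ⊆ arcSet G := by
    intro e he
    rw [List.mem_toFinset] at he
    exact mem_arcSet.2 (hT.forward.traced e he).2.2.1
  have h2 := Finset.card_le_card h1
  rwa [List.toFinset_card_of_nodup hT.forward.nodup_trace, List.length_map] at h2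

theorem arcSet_update {G G' : Data n} {v w : Fin n}
    (h : G'.outList = Function.update G.outList v (w :: G.outList v)) :
    arcSet G' = Insert.insert (v, w) (arcSet G) := by
  ext ⟨a, b⟩
  simp only [mem_arcSet, Finset.mem_insert, h, Prod.mk.injEq]
  by_cases ha : a = v
  · subst ha; simp
  · simp [ha]

theorem card_arcSet_update {G G' : Data n} {v w : Fin n}
    (h : G'.outList = Function.update G.outList v (w :: G.outList v)) (hw : w ∉ G.outList v) :
    (arcSet G').card = (arcSet G).card + 1 := by
  rw [arcSet_update h, Finset.card_insert_of_notMem]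
  rwa [mem_arcSet]

theorem mem_outList_of_update {G G' : Data n} {v w : Fin n}
    (h : G'.outList = Function.update G.outList v (w :: G.outList v)) {a b : Fin n} :
    b ∈ G'.outList a ↔ b ∈ G.outList a ∨ (a = v ∧ b = w) := by
  rw [h]
  by_cases ha : a = v
  · subst ha; simp [or_comm]
  · simp [ha]

theorem relatedPairs_subset_update {G G' : Data n} {v w : Fin n}
    (h : G'.outList = Function.update G.outList v (w :: G.outList v)) :
    relatedPairs G ⊆ relatedPairs G' := by
  intro p hp
  rw [mem_relatedPairs] at hp ⊢
  refine ⟨?_, ?_, Relation.ReflTransGen.mono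
    (fun a b hab => (mem_outList_of_update h).2 (Or.inl hab)) _ _ hp.2.2⟩
  · rw [arcSet_update h]; exact Finset.mem_insert_of_mem hp.1
  · rw [arcSet_update h]; exact Finset.mem_insert_of_mem hp.2.1

/-- A compatible search with `k` steps creates at least `k² / 2` newly related pairs of arcs. -/
theorem card_relatedPairs_update {G G' : Data n} (hG : GoodData G) {v w : Fin n}
    {S : SearchState n} {T : List ((Fin n × Fin n) × (Fin n × Fin n))}
    (hT : TraceInv G v w S T)
    (h : G'.outList = Function.update G.outList v (w :: G.outList v)) :
    2 * (relatedPairs G).card + T.length ^ 2 ≤ 2 * (relatedPairs G').card := by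
  classical
  have hnd : T.Nodup := List.Nodup.of_map _ hT.forward.nodup_trace
  set P := (T.toFinset ×ˢ T.toFinset).filter
    fun q => G.order.idxOf q.1.1.1 < G.order.idxOf q.2.2.2 with hP
  have hcard : T.length ^ 2 ≤ 2 * P.card := by
    -- If `u` of `e` is not before `z` of `f`, then `u` of `f` is before `z` of `f`, which is not
    -- after `u` of `e`, which is before `z` of `e`; so the swapped pair lies in `P`.
    have hsub : T.toFinset ×ˢ T.toFinset ⊆ P ∪ P.image Prod.swap := by
      rintro ⟨e, f⟩ hef
      obtain ⟨he, hf⟩ := Finset.mem_product.1 hef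
      have h1 := hT.compatible e (by simpa using he)
      have h2 := hT.compatible f (by simpa using hf)
      rw [Finset.mem_union]
      by_cases hlt : G.order.idxOf e.1.1 < G.order.idxOf f.2.2
      · left
        exact Finset.mem_filter.2 ⟨hef, hlt⟩
      · right
        refine Finset.mem_image.2 ⟨(f, e), Finset.mem_filter.2
          ⟨Finset.mem_product.2 ⟨hf, he⟩, ?_⟩, rfl⟩
        simp only
        omega
    have h1 := Finset.card_le_card hsub
    have h2 := Finset.card_union_le P (P.image Prod.swap)
    have h3 : (P.image Prod.swap).card ≤ P.card := Finset.card_image_le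
    rw [Finset.card_product, List.toFinset_card_of_nodup hnd, ← sq] at h1
    omega
  have hinj : Set.InjOn (fun q : ((Fin n × Fin n) × (Fin n × Fin n)) ×
      ((Fin n × Fin n) × (Fin n × Fin n)) => (q.2.2, q.1.1)) P := by
    rintro ⟨e, f⟩ hq ⟨e', f'⟩ hq' heq
    obtain ⟨he, hf⟩ := Finset.mem_product.1 (Finset.mem_filter.1 hq).1
    obtain ⟨he', hf'⟩ := Finset.mem_product.1 (Finset.mem_filter.1 hq').1
    simp only [List.mem_toFinset] at he hf he' hf'
    simp only [Prod.mk.injEq] at heq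
    have h1 := List.inj_on_of_nodup_map hT.forward.nodup_trace he he' heq.2
    have h2 := List.inj_on_of_nodup_map hT.backward.nodup_trace hf hf'
      (congrArg Prod.swap heq.1)
    rw [h1, h2]
  -- A path from `z` to `u` in the old graph would force `z ≤ u`.
  have hdisj : Disjoint (relatedPairs G) (P.image fun q => (q.2.2, q.1.1)) := by
    rw [Finset.disjoint_left]
    intro p hp hp'
    obtain ⟨q, hq, rfl⟩ := Finset.mem_image.1 hp'
    have h1 := (Finset.mem_filter.1 hq).2
    have h2 := hG.idxOf_le_of_reach (mem_relatedPairs.1 hp).2.2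
    simp only at h2
    omega
  have hsub : relatedPairs G ∪ (P.image fun q => (q.2.2, q.1.1)) ⊆ relatedPairs G' := by
    apply Finset.union_subset (relatedPairs_subset_update h)
    intro p hp
    obtain ⟨⟨e, f⟩, hq, rfl⟩ := Finset.mem_image.1 hp
    obtain ⟨he, hf⟩ := Finset.mem_product.1 (Finset.mem_filter.1 hq).1
    rw [List.mem_toFinset] at he hf
    obtain ⟨e1, -, e3, -⟩ := hT.forward.traced e.1 (List.mem_map_of_mem he)
    obtain ⟨f1, -, f3, -⟩ := hT.backward.traced f.2.swap
      (List.mem_map.2 ⟨f, hf, rfl⟩)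
    have hmono : ∀ {a b : Fin n}, b ∈ G.outList a → b ∈ G'.outList a :=
      fun hab => (mem_outList_of_update h).2 (Or.inl hab)
    rw [mem_relatedPairs]
    refine ⟨mem_arcSet.2 (hmono ((hG.mem_inList _ _).1 f3)), mem_arcSet.2 (hmono e3), ?_⟩
    have p1 := Relation.ReflTransGen.mono (fun a b => hmono) _ _ (hT.reach_backward hG f1)
    have p2 := Relation.ReflTransGen.mono (fun a b => hmono) _ _ (hT.forward.reach _ e1)
    -- The connecting path runs from `z` to `v`, over the new arc to `w`, and on to `u`.
    exact (p1.tail ((mem_outList_of_update h).2 (Or.inr ⟨rfl, rfl⟩))).trans p2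
  have h1 := Finset.card_le_card hsub
  rw [Finset.card_union_of_disjoint hdisj, Finset.card_image_of_injOn hinj] at h1
  omega

end Related

/-! ### Restoring the topological order -/

section Reorder

variable {n : ℕ}

theorem idxOf_lt_of_pairwise {N : List (Fin n)} {R : Fin n → Fin n → Prop} {a b : Fin n}
    (hN : N.Pairwise fun x y => ¬ R y x) (ha : a ∈ N) (hb : b ∈ N) (hab : R a b) (hne : a ≠ b) :
    N.idxOf a < N.idxOf b := by
  by_contra hlt
  have hne' : N.idxOf b ≠ N.idxOf a := fun h => hne ((List.idxOf_inj hb).1 h).symm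
  have hlt' : N.idxOf b < N.idxOf a := by omega
  have := List.pairwise_iff_getElem.1 hN (N.idxOf b) (N.idxOf a) (List.idxOf_lt_length_iff.2 hb)
    (List.idxOf_lt_length_iff.2 ha) hlt'
  rw [List.getElem_idxOf, List.getElem_idxOf] at this
  exact this hab

theorem pairwise_idxOf_lt {l : List (Fin n)} (hl : l.Nodup) :
    l.Pairwise fun a b => l.idxOf a < l.idxOf b := by
  rw [List.pairwise_iff_getElem]
  intro i j hi hj hij
  rwa [hl.idxOf_getElem, hl.idxOf_getElem]

theorem idxOf_of_append {L R : List (Fin n)} {t : Fin n} (hnd : (L ++ t :: R).Nodup) (x : Fin n) :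
    (x ∈ L → (L ++ t :: R).idxOf x < (L ++ t :: R).idxOf t) ∧
    (x ∈ R → (L ++ t :: R).idxOf t < (L ++ t :: R).idxOf x) := by
  have h := List.pairwise_append.1 (pairwise_idxOf_lt hnd)
  exact ⟨fun hx => h.2.2 x hx t (by simp), fun hx => (List.pairwise_cons.1 h.2.1).1 x hx⟩

theorem moveBefore_perm (t : Fin n) (xs : List (Fin n)) :
    ∀ ord : List (Fin n), (∀ x ∈ xs, x ∈ ord) → (moveBefore t xs ord).val.Perm ord := by
  induction xs with
  | nil => intro ord _; exact List.Perm.refl _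
  | cons x xs ih =>
    intro ord h
    have hstep : (insertBefore t x (ord.erase x)).val.Perm ord := by
      refine List.perm_middle.trans ?_
      rw [List.takeWhile_append_dropWhile]
      exact (List.perm_cons_erase (h x (by simp))).symm
    exact (ih _ fun y hy => hstep.mem_iff.2 (h y (by simp [hy]))).trans hstep

theorem moveAfter_perm (t : Fin n) (xs : List (Fin n)) (ht : t ∉ xs) :
    ∀ ord : List (Fin n), t ∈ ord → (∀ x ∈ xs, x ∈ ord) → (moveAfter t xs ord).val.Perm ord := by
  induction xs with
  | nil => intro ord _ _; exact List.Perm.refl _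
  | cons x xs ih =>
    intro ord htord h
    simp only [List.mem_cons, not_or] at ht
    have hstep : (insertAfter t x (ord.erase x)).val.Perm ord := by
      have h1 : t ∈ ord.erase x := (List.mem_erase_of_ne ht.1).2 htord
      obtain ⟨L, R, hLR, htL⟩ := List.eq_append_cons_of_mem h1
      have h2 : (insertAfter t x (ord.erase x)).val = L ++ [t] ++ x :: R := by
        rw [hLR]
        simp only [insertAfter]
        rw [takeWhile_ne_append _ htL, dropWhile_ne_append _ htL]
        simp
      rw [h2]
      refine List.perm_middle.trans ?_
      have h3 : L ++ [t] ++ R = ord.erase x := by rw [hLR]; simp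
      rw [h3]
      exact (List.perm_cons_erase (h x (by simp))).symm
    exact (ih ht.2 _ (hstep.mem_iff.2 htord)
      fun y hy => hstep.mem_iff.2 (h y (by simp [hy]))).trans hstep

/-- What is known about the vertices `Fs` and `Bs` that are moved when the arc `(v, w)` is added
and `t` is the least live forward vertex or `v`. -/
structure MoveInv (G : Data n) (v w t : Fin n) (F B Fs Bs : List (Fin n)) : Prop where
  mem_Fs : ∀ x, x ∈ Fs ↔ x ∈ F ∧ G.order.idxOf x < G.order.idxOf t
  mem_Bs : ∀ x, x ∈ Bs ↔ x ∈ B ∧ G.order.idxOf t < G.order.idxOf x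
  nodup_Fs : Fs.Nodup
  nodup_Bs : Bs.Nodup
  disjoint : ∀ x ∈ F, x ∉ B
  w_mem : w ∈ F
  v_mem : v ∈ B
  w_lt_v : G.order.idxOf w < G.order.idxOf v
  closed_F : ∀ x ∈ Fs, ∀ y ∈ G.outList x, y ∈ F
  closed_B : ∀ x ∈ Bs, ∀ y ∈ G.inList x, y ∈ B
  sorted_Fs : Fs.Pairwise fun a b => a ∉ G.outList b
  sorted_Bs : Bs.Pairwise fun a b => a ∉ G.inList b

/-- All arcs out of `Fs` end in `F`. So none ends in `v`, and none ends in an unmoved vertex before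
`v`, since such a vertex of `F` would itself be in `Fs`. -/
theorem MoveInv.pairwise_after {G : Data n} (hG : GoodData G) {v w : Fin n}
    {F B Fs Bs : List (Fin n)} (h : MoveInv G v w v F B Fs Bs) :
    (moveAfter v Fs.reverse G.order).val.Perm G.order ∧
    (moveAfter v Fs.reverse G.order).val.Pairwise
      fun a b => ¬ (a ∈ G.outList b ∨ (b = v ∧ a = w)) := by
  have hvF : v ∉ F := fun hv => h.disjoint v hv h.v_mem
  have hvs : v ∉ Fs.reverse := fun hv => hvF ((h.mem_Fs v).1 (List.mem_reverse.1 hv)).1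
  refine ⟨moveAfter_perm v _ hvs _ (hG.complete v) fun x _ => hG.complete x, ?_⟩
  obtain ⟨L, R, hLR⟩ := List.append_of_mem (hG.complete v)
  have hnd := hG.nodup
  rw [hLR] at hnd
  have hval := moveAfter_val Fs.reverse L [] R hvs (List.nodup_reverse.2 h.nodup_Fs) (by simp)
    (by simpa using hnd)
  rw [List.nil_append, ← hLR] at hval
  rw [hval]
  have hL : ∀ x ∈ L, G.order.idxOf x < G.order.idxOf v := by
    rw [hLR]; exact fun x => (idxOf_of_append hnd x).1
  have hR : ∀ x ∈ R, G.order.idxOf v < G.order.idxOf x := by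
    rw [hLR]; exact fun x => (idxOf_of_append hnd x).2
  have hbase := pairwise_idxOf_lt hG.nodup
  rw [hLR, List.pairwise_append, ← hLR] at hbase
  have hold : ∀ a b, G.order.idxOf a < G.order.idxOf b → a ∉ G.outList b := by
    intro a b hab hmem
    have := hG.topological b a hmem
    omega
  have hFs : ∀ a ∈ Fs, a ∈ F ∧ G.order.idxOf a < G.order.idxOf v := fun a => (h.mem_Fs a).1
  have hFs' := h.mem_Fs
  have hcl := h.closed_F
  have hlt := h.w_lt_v
  have hwF := h.w_mem
  simp only [List.reverse_reverse, List.append_nil, List.mem_reverse]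
  rw [List.pairwise_append, List.pairwise_cons, List.pairwise_append]
  refine ⟨?_, ⟨?_, ?_, ?_, ?_⟩, ?_⟩
  · refine (hbase.1.filter _).imp_of_mem ?_
    intro a b ha hb hab hor
    rcases hor with hor | ⟨rfl, rfl⟩
    · exact hold a b hab hor
    · have := hL _ (List.mem_of_mem_filter hb)
      omega
  · intro b hb hor
    rcases List.mem_append.1 hb with hb | hb
    · rcases hor with hor | ⟨rfl, rfl⟩
      · exact hvF (hcl b hb v hor)
      · omega
    · have := hR b (List.mem_of_mem_filter hb)
      rcases hor with hor | ⟨rfl, rfl⟩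
      · exact hold v b this hor
      · omega
  · refine h.sorted_Fs.imp_of_mem ?_
    intro a b ha hb hab hor
    rcases hor with hor | ⟨rfl, rfl⟩
    · exact hab hor
    · exact hvF (hFs _ hb).1
  · refine ((List.pairwise_cons.1 hbase.2.1).2.filter _).imp_of_mem ?_
    intro a b ha hb hab hor
    rcases hor with hor | ⟨rfl, rfl⟩
    · exact hold a b hab hor
    · have := hR _ (List.mem_of_mem_filter hb)
      omega
  · intro a ha b hb hor
    have h1 := (hFs a ha).2
    have h2 := hR b (List.mem_of_mem_filter hb)
    rcases hor with hor | ⟨rfl, rfl⟩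
    · exact hold a b (by omega) hor
    · omega
  · intro a ha b hb hor
    have haL := hL a (List.mem_of_mem_filter ha)
    have haFs : a ∉ Fs := by simpa using (List.mem_filter.1 ha).2
    have haF : a ∉ F := fun hh => haFs ((hFs' a).2 ⟨hh, haL⟩)
    rcases hor with hor | ⟨rfl, rfl⟩
    · rcases List.mem_cons.1 hb with rfl | hb
      · exact hold a _ haL hor
      · rcases List.mem_append.1 hb with hb | hb
        · exact haF (hcl b hb a hor)
        · have := hR b (List.mem_of_mem_filter hb)
          exact hold a b (by omega) hor
    · exact haF hwF

/-- Here `v` lies in `Bs` and so ends up before every vertex of `F`. Closedness of `Fs` under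
successors and of `Bs` under predecessors, with `F` and `B` disjoint, excludes arcs from `Fs` to
`Bs` and arcs between moved and unmoved vertices that would point backwards. -/
theorem MoveInv.pairwise_before {G : Data n} (hG : GoodData G) {v w t : Fin n}
    {F B Fs Bs : List (Fin n)} (h : MoveInv G v w t F B Fs Bs) (htF : t ∈ F)
    (htv : G.order.idxOf t < G.order.idxOf v) :
    (moveBefore t (Bs.reverse ++ Fs) G.order).val.Perm G.order ∧
    (moveBefore t (Bs.reverse ++ Fs) G.order).val.Pairwise
      fun a b => ¬ (a ∈ G.outList b ∨ (b = v ∧ a = w)) := by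
  refine ⟨moveBefore_perm t _ _ fun x _ => hG.complete x, ?_⟩
  have hvF : v ∉ F := fun hv => h.disjoint v hv h.v_mem
  have hvBs : v ∈ Bs := (h.mem_Bs v).2 ⟨h.v_mem, htv⟩
  have hts : t ∉ Bs.reverse ++ Fs := by
    rw [List.mem_append, List.mem_reverse]
    rintro (ht | ht)
    · exact absurd ((h.mem_Bs t).1 ht).2 (by omega)
    · exact absurd ((h.mem_Fs t).1 ht).2 (by omega)
  have hnds : (Bs.reverse ++ Fs).Nodup := by
    rw [List.nodup_append]
    refine ⟨List.nodup_reverse.2 h.nodup_Bs, h.nodup_Fs, ?_⟩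
    rintro a ha b hb rfl
    exact h.disjoint a ((h.mem_Fs a).1 hb).1 ((h.mem_Bs a).1 (List.mem_reverse.1 ha)).1
  obtain ⟨L, R, hLR⟩ := List.append_of_mem (hG.complete t)
  have hnd := hG.nodup
  rw [hLR] at hnd
  have hval := moveBefore_val (Bs.reverse ++ Fs) L [] R hts hnds (by simp) (by simpa using hnd)
  rw [List.append_nil, ← hLR] at hval
  rw [hval]
  have hL : ∀ x ∈ L, G.order.idxOf x < G.order.idxOf t := by
    rw [hLR]; exact fun x => (idxOf_of_append hnd x).1
  have hR : ∀ x ∈ R, G.order.idxOf t < G.order.idxOf x := by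
    rw [hLR]; exact fun x => (idxOf_of_append hnd x).2
  have hbase := pairwise_idxOf_lt hG.nodup
  rw [hLR, List.pairwise_append, ← hLR] at hbase
  have hold : ∀ a b, G.order.idxOf a < G.order.idxOf b → a ∉ G.outList b := by
    intro a b hab hmem
    have := hG.topological b a hmem
    omega
  have hFs : ∀ a ∈ Fs, a ∈ F ∧ G.order.idxOf a < G.order.idxOf t := fun a => (h.mem_Fs a).1
  have hBs : ∀ a ∈ Bs, a ∈ B ∧ G.order.idxOf t < G.order.idxOf a := fun a => (h.mem_Bs a).1
  have hclB : ∀ x ∈ Bs, ∀ y, x ∈ G.outList y → y ∈ B :=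
    fun x hx y hy => h.closed_B x hx y ((hG.mem_inList _ _).2 hy)
  rw [List.append_nil, List.pairwise_append, List.pairwise_append, List.pairwise_append,
    List.pairwise_cons]
  simp only [List.mem_append, List.mem_reverse, List.mem_cons, List.mem_filter,
    decide_eq_true_eq, not_or]
  refine ⟨⟨?_, ⟨?_, ?_, ?_⟩, ?_⟩, ⟨?_, ?_⟩, ?_⟩
  · refine (hbase.1.filter _).imp_of_mem ?_
    intro a b ha hb hab
    refine ⟨hold a b hab, ?_⟩
    rintro ⟨rfl, rfl⟩
    have := hL _ (List.mem_of_mem_filter hb)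
    omega
  · rw [List.pairwise_reverse]
    refine h.sorted_Bs.imp_of_mem ?_
    intro b a hb ha hab
    refine ⟨fun hh => hab ((hG.mem_inList _ _).2 hh), ?_⟩
    rintro ⟨rfl, rfl⟩
    exact h.disjoint _ h.w_mem (hBs _ ha).1
  · refine h.sorted_Fs.imp_of_mem ?_
    intro a b ha hb hab
    refine ⟨hab, ?_⟩
    rintro ⟨rfl, rfl⟩
    exact hvF (hFs _ hb).1
  · intro a ha b hb
    refine ⟨fun hh => h.disjoint a (h.closed_F b hb a hh) (hBs a ha).1, ?_⟩
    rintro ⟨rfl, rfl⟩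
    exact hvF (hFs _ hb).1
  · rintro a ⟨haL, haB, haF⟩ b hb
    have h1 := hL a haL
    have haF' : a ∉ F := fun hh => haF ((h.mem_Fs a).2 ⟨hh, h1⟩)
    refine ⟨?_, ?_⟩
    · rcases hb with hb | hb
      · exact hold a b (h1.trans (hBs b hb).2)
      · exact fun hh => haF' (h.closed_F b hb a hh)
    · rintro ⟨rfl, rfl⟩
      exact haF' h.w_mem
  · rintro b ⟨hbR, hbB, -⟩
    refine ⟨hold t b (hR b hbR), ?_⟩
    rintro ⟨rfl, rfl⟩
    exact hbB hvBs
  · refine ((List.pairwise_cons.1 hbase.2.1).2.filter _).imp_of_mem ?_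
    intro a b ha hb hab
    refine ⟨hold a b hab, ?_⟩
    rintro ⟨rfl, rfl⟩
    simp [hvBs] at hb
  · rintro a ha b hb
    refine ⟨?_, ?_⟩
    · rcases ha with ⟨haL, -, -⟩ | ha | ha
      · rcases hb with rfl | ⟨hbR, -⟩
        · exact hold a _ (hL a haL)
        · exact hold a b ((hL a haL).trans (hR b hbR))
      · intro hh
        have hbB := hclB a ha b hh
        rcases hb with rfl | ⟨hbR, hb1, -⟩
        · exact h.disjoint _ htF hbB
        · exact hb1 ((h.mem_Bs b).2 ⟨hbB, hR b hbR⟩)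
      · rcases hb with rfl | ⟨hbR, -⟩
        · exact hold a _ (hFs a ha).2
        · exact hold a b ((hFs a ha).2.trans (hR b hbR))
    · rintro ⟨rfl, rfl⟩
      rcases hb with rfl | ⟨-, hb1, -⟩
      · omega
      · exact hb1 hvBs

end Reorder

/-! ### Cost and effect of completing a search -/

section Finish

variable {n : ℕ}

theorem findT_spec (ord : List (Fin n)) (v : Fin n) (S : SearchState n) :
    (findT ord v S).time ≤ 2 * S.F.length ∧
    ((findT ord v S).val = v ∨ ((findT ord v S).val ∈ S.F ∧ S.out (findT ord v S).val ≠ [])) ∧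
    ord.idxOf (findT ord v S).val ≤ ord.idxOf v ∧
    ∀ x ∈ S.F, S.out x ≠ [] → ord.idxOf (findT ord v S).val ≤ ord.idxOf x := by
  have gen : ∀ (l : List (Fin n)) (t : Fin n),
      let r := l.foldlM (fun t x => do
        tick
        if S.out x = [] then return t
        else if ← less ord x t then return x else return t) t
      r.time ≤ 2 * l.length ∧ (r.val = t ∨ (r.val ∈ l ∧ S.out r.val ≠ [])) ∧
      ord.idxOf r.val ≤ ord.idxOf t ∧
      ∀ x ∈ l, S.out x ≠ [] → ord.idxOf r.val ≤ ord.idxOf x := by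
    intro l
    induction l with
    | nil => intro t; simp
    | cons a l ih =>
      intro t r
      obtain ⟨i1, i2, i3, i4⟩ := ih
        (if S.out a = [] then t else if ord.idxOf a < ord.idxOf t then a else t)
      set r' := (l.foldlM (fun t x => do
        tick
        if S.out x = [] then return t
        else if ← less ord x t then return x else return t)
          (if S.out a = [] then t else if ord.idxOf a < ord.idxOf t then a else t) : Timed _)
      have hr : r.val = r'.val ∧ r.time ≤ 2 + r'.time := by
        simp only [r, List.foldlM_cons, Timed.val_bind, Timed.time_bind]
        by_cases h1 : S.out a = []
        · simp [r', h1]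
        · by_cases h2 : ord.idxOf a < ord.idxOf t
          · simp [r', h1, h2]
          · simp [r', h1, h2]
      rw [hr.1]
      refine ⟨?_, ?_, ?_, ?_⟩
      · simp only [List.length_cons]; omega
      · rcases i2 with h | h
        · rw [h]
          by_cases h1 : S.out a = []
          · simp [h1]
          · by_cases h2 : ord.idxOf a < ord.idxOf t <;> simp [h1, h2]
        · exact Or.inr ⟨List.mem_cons_of_mem _ h.1, h.2⟩
      · refine i3.trans ?_
        split
        · exact le_rfl
        · split <;> omega
      · intro x hx hox
        rcases List.mem_cons.1 hx with rfl | hx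
        · refine i3.trans ?_
          rw [if_neg hox]
          split <;> omega
        · exact i4 x hx hox
  exact gen S.F v

/-- A null pointer means that all arcs of the vertex have been traversed, and arcs of different
vertices are different members of `T`. -/
theorem HalfTrace.sum_length_le {adj : Fin n → List (Fin n)} (hadj : ∀ x, (adj x).Nodup)
    {root : Fin n} {F : List (Fin n)} {out : Fin n → List (Fin n)} {T : List (Fin n × Fin n)}
    (h : HalfTrace adj root F out T) {vs : List (Fin n)} (hvs : vs.Nodup)
    (hsub : ∀ x ∈ vs, x ∈ F ∧ out x = []) :
    (vs.map fun x => (adj x).length).sum ≤ T.length := by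
  have hnd : (vs.flatMap fun x => (adj x).map fun y => (x, y)).Nodup := by
    rw [List.nodup_flatMap]
    refine ⟨fun x _ => (hadj x).map fun a b hab => (Prod.mk.inj hab).2, ?_⟩
    refine hvs.imp ?_
    intro a b hab p hp hp'
    obtain ⟨y, -, rfl⟩ := List.mem_map.1 hp
    obtain ⟨y', -, heq⟩ := List.mem_map.1 hp'
    exact hab (Prod.mk.inj heq).1.symm
  have hs : (vs.flatMap fun x => (adj x).map fun y => (x, y)) ⊆ T := by
    intro p hp
    obtain ⟨x, hx, hp⟩ := List.mem_flatMap.1 hp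
    obtain ⟨y, hy, rfl⟩ := List.mem_map.1 hp
    obtain ⟨h1, h2⟩ := hsub x hx
    exact h.cover x h1 y hy (by simp [h2])
  have := (hnd.subperm hs).length_le
  simpa [List.length_flatMap] using this

theorem goodData_add {G G' : Data n} (hG : GoodData G) {v w : Fin n} (hvw : v ≠ w)
    (hw : w ∉ G.outList v)
    (hout : G'.outList = Function.update G.outList v (w :: G.outList v))
    (hin : G'.inList = Function.update G.inList w (v :: G.inList w))
    (hperm : G'.order.Perm G.order)
    (hpw : G'.order.Pairwise fun a b => ¬ (a ∈ G.outList b ∨ (b = v ∧ a = w))) :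
    GoodData G' := by
  have hcomp : ∀ x, x ∈ G'.order := fun x => hperm.mem_iff.2 (hG.complete x)
  refine ⟨hperm.nodup_iff.2 hG.nodup, hcomp, ?_, ?_, ?_, ?_⟩
  · intro a b
    rw [mem_outList_of_update hout, hin, ← hG.mem_inList]
    by_cases hb : b = w
    · subst hb; simp [or_comm]
    · simp [hb]
  · intro a
    rw [hout]
    by_cases ha : a = v
    · subst ha
      rw [Function.update_self, List.nodup_cons]
      exact ⟨hw, hG.nodup_out a⟩
    · rw [Function.update_of_ne ha]; exact hG.nodup_out a
  · intro a
    rw [hin]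
    by_cases ha : a = w
    · subst ha
      rw [Function.update_self, List.nodup_cons, hG.mem_inList]
      exact ⟨hw, hG.nodup_in a⟩
    · rw [Function.update_of_ne ha]; exact hG.nodup_in a
  · intro a b hb
    rw [mem_outList_of_update hout] at hb
    refine idxOf_lt_of_pairwise (R := fun x y => y ∈ G.outList x ∨ (x = v ∧ y = w)) hpw
      (hcomp a) (hcomp b) hb ?_
    rintro rfl
    rcases hb with hb | ⟨h1, h2⟩
    · exact lt_irrefl _ (hG.topological _ _ hb)
    · exact hvw (h1.symm.trans h2)

set_option maxHeartbeats 1000000 in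
/-- The topological order is restored in time linear in the number of traversed arcs. -/
theorem finish_spec {G : Data n} (hG : GoodData G) {v w : Fin n} {S : SearchState n}
    {T : List ((Fin n × Fin n) × (Fin n × Fin n))}
    (hL : LiveInv (fun x => G.order.idxOf x) S) (hT : TraceInv G v w S T)
    (hend : (S.FA = [] ∧ S.FP = []) ∨ (S.BA = [] ∧ S.BP = []))
    (hwv : G.order.idxOf w < G.order.idxOf v) (hw : w ∉ G.outList v) :
    (finish G v w S).time ≤ 50 * (T.length + 1) ∧ GoodData (finish G v w S).val ∧
    (finish G v w S).val.outList = Function.update G.outList v (w :: G.outList v) := by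
  obtain ⟨t1, t2, t3, t4⟩ := findT_spec G.order v S
  set tt := findT G.order v S with htt
  set t := tt.val with ht
  have hFval := split_val (fun x => less G.order x t) S.F
  have hBval := split_val (fun x => less G.order t x) S.B
  have hFtime := split_time_le (fun x => less G.order x t) 1 (fun _ => le_rfl) S.F
  have hBtime := split_time_le (fun x => less G.order t x) 1 (fun _ => le_rfl) S.B
  simp only [less_val] at hFval hBval
  set f := split (fun x => less G.order x t) S.F with hf
  set b := split (fun x => less G.order t x) S.B with hb
  have hf1 : ∀ x, x ∈ f.val.1 ↔ x ∈ S.F ∧ G.order.idxOf x < G.order.idxOf t := by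
    intro x; rw [hFval]; simp
  have hb1 : ∀ x, x ∈ b.val.1 ↔ x ∈ S.B ∧ G.order.idxOf t < G.order.idxOf x := by
    intro x; rw [hBval]; simp
  have hfnd : f.val.1.Nodup := by rw [hFval]; exact hT.forward.nodup.filter _
  have hbnd : b.val.1.Nodup := by rw [hBval]; exact hT.backward.nodup.filter _
  have hflen : f.val.1.length ≤ S.F.length := by rw [hFval]; exact List.length_filter_le _ _
  have hblen : b.val.1.length ≤ S.B.length := by rw [hBval]; exact List.length_filter_le _ _
  have hfnull : ∀ x ∈ f.val.1, x ∈ S.F ∧ S.out x = [] := by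
    intro x hx
    obtain ⟨h1, h2⟩ := (hf1 x).1 hx
    refine ⟨h1, ?_⟩
    by_contra h3
    have := t4 x h1 h3
    omega
  -- If `t = v`, no backward vertex lies after `t`, since each of them reaches `v`. Otherwise `t` is
  -- unfinished, and so would be a violating `x > t`; the frontier would make both live, but one
  -- side has no live vertices left.
  have hbnull : ∀ x ∈ b.val.1, x ∈ S.B ∧ S.inn x = [] := by
    intro x hx
    obtain ⟨h1, h2⟩ := (hb1 x).1 hx
    refine ⟨h1, ?_⟩
    by_contra h3
    rcases t2 with h | ⟨h4, h5⟩
    · have := hG.idxOf_le_of_reach (hT.reach_backward hG h1)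
      rw [h] at h2
      omega
    · rcases hL.frontier t h4 h5 x h1 h3 with h | ⟨h, h'⟩
      · omega
      · rcases hend with ⟨e1, e2⟩ | ⟨e1, e2⟩
        · simp [e1, e2] at h
        · simp [e1, e2] at h'
  obtain ⟨p1, p2, p3⟩ := topSort_spec
    (inSub := fun x => do if ← mem x S.F then less G.order x t else return false)
    f.val.1 hfnd (by intro x; by_cases hx : x ∈ S.F <;> simp [hx, hf1])
    (by intro x; by_cases hx : x ∈ S.F <;> simp [hx]) G.outList hG.nodup_out
    (fun x => G.order.idxOf x) (fun x _ y hy _ => hG.topological x y hy)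
  obtain ⟨q1, q2, q3⟩ := topSort_spec
    (inSub := fun y => do if ← mem y S.B then less G.order t y else return false)
    b.val.1 hbnd (by intro x; by_cases hx : x ∈ S.B <;> simp [hx, hb1])
    (by intro x; by_cases hx : x ∈ S.B <;> simp [hx]) G.inList hG.nodup_in
    -- Incoming lists run against the order, so the rank is the complement of the position.
    (fun x => G.order.length - G.order.idxOf x) (fun x _ y hy _ => by
      have h1 := hG.topological y x ((hG.mem_inList _ _).1 hy)
      have h2 := List.idxOf_lt_length_iff.2 (hG.complete x)
      omega)
  set Fs := topSort G.outList
    (fun x => do if ← mem x S.F then less G.order x t else return false) f.val.1 with hFs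
  set Bs := topSort G.inList
    (fun y => do if ← mem y S.B then less G.order t y else return false) b.val.1 with hBs
  have hsumF := hT.forward.sum_length_le hG.nodup_out hfnd hfnull
  have hsumB := hT.backward.sum_length_le hG.nodup_in hbnd hbnull
  have hmove : MoveInv G v w t S.F S.B Fs.val Bs.val := by
    refine ⟨fun x => p1.mem_iff.trans (hf1 x), fun x => q1.mem_iff.trans (hb1 x),
      p1.nodup_iff.2 hfnd, q1.nodup_iff.2 hbnd, hT.disjoint, hT.forward.root_mem,
      hT.backward.root_mem, hwv, ?_, ?_, p2, q2⟩
    · intro x hx y hy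
      obtain ⟨h1, h2⟩ := hfnull x (p1.mem_iff.1 hx)
      exact (hT.forward.traced _ (hT.forward.cover x h1 y hy (by simp [h2]))).2.1
    · intro x hx y hy
      obtain ⟨h1, h2⟩ := hbnull x (q1.mem_iff.1 hx)
      exact (hT.backward.traced _ (hT.backward.cover x h1 y hy (by simp [h2]))).2.1
  set mv : Timed (List (Fin n)) := if t = v then moveAfter t Fs.val.reverse G.order
    else moveBefore t (Bs.val.reverse ++ Fs.val) G.order with hmv
  have hvw : v ≠ w := by rintro rfl; exact lt_irrefl _ hwv
  have hval : (finish G v w S).val = { G with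
      order := mv.val, out := S.out, inn := S.inn
      outList := Function.update G.outList v (w :: G.outList v)
      inList := Function.update G.inList w (v :: G.inList w) } := by
    unfold finish
    simp only [Timed.val_bind]
    by_cases htv : (findT G.order v S).val = v
    · rw [if_pos htv, hmv, if_pos htv]; rfl
    · rw [if_neg htv, hmv, if_neg htv]; rfl
  have htime : (finish G v w S).time = tt.time + (f.time + (b.time + (Fs.time + (Bs.time +
      ((Fs.val.forM fun _ => tick).time + ((Bs.val.forM fun _ => tick).time + (1 + (mv.time +
      (S.F.length + 1 + (S.B.length + 1 + (S.FA.length + 1 + (S.FP.length + 1 +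
      (S.BA.length + 1 + (S.BP.length + 1 + (1 + (1 + 0)))))))))))))))) := by
    unfold finish
    simp only [Timed.time_bind]
    by_cases htv : (findT G.order v S).val = v
    · rw [if_pos htv, hmv, if_pos htv]; rfl
    · rw [if_neg htv, hmv, if_neg htv]; rfl
  have hreord : mv.val.Perm G.order ∧
      mv.val.Pairwise fun a b => ¬ (a ∈ G.outList b ∨ (b = v ∧ a = w)) := by
    by_cases htv : t = v
    · rw [hmv, if_pos htv, htv]
      rw [htv] at hmove
      exact hmove.pairwise_after hG
    · rw [hmv, if_neg htv]
      refine hmove.pairwise_before hG (t2.resolve_left htv).1 ?_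
      have : G.order.idxOf t ≠ G.order.idxOf v := fun h => htv (hG.injective h)
      omega
  have hmvt : mv.time ≤ 2 * (Fs.val.length + Bs.val.length) := by
    by_cases htv : t = v
    · rw [hmv, if_pos htv, moveAfter_time, List.length_reverse]; omega
    · rw [hmv, if_neg htv, moveBefore_time, List.length_append, List.length_reverse]; omega
  refine ⟨?_, ?_, by rw [hval]⟩
  · rw [htime, forM_tick_time, forM_tick_time]
    have l1 := p1.length_eq
    have l2 := q1.length_eq
    have l3 := hT.forward.length_le
    have l4 := hT.backward.length_le
    have l5 := (hL.nodup_F.subperm (l₂ := S.F) fun x hx =>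
      (hL.live_F x (List.mem_append.1 hx)).1).length_le
    have l6 := (hL.nodup_B.subperm (l₂ := S.B) fun x hx =>
      (hL.live_B x (List.mem_append.1 hx)).1).length_le
    rw [List.length_append] at l5 l6
    rw [List.length_map] at l3 l4 hsumF hsumB
    simp only [Timed.time_tick]
    have m1 : tt.time + f.time + b.time ≤ 6 * (T.length + 1) := by omega
    have m2 : Fs.time ≤ 11 * (T.length + 1) := by omega
    have m3 : Bs.time ≤ 11 * (T.length + 1) := by omega
    have m4 : Fs.val.length ≤ T.length + 1 := by omega
    have m5 : Bs.val.length ≤ T.length + 1 := by omega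
    have m6 : S.F.length + S.B.length + S.FA.length + S.FP.length + S.BA.length + S.BP.length ≤
      4 * (T.length + 1) := by omega
    clear l1 l2 l3 l4 l5 l6 p3 q3 hsumF hsumB hflen hblen hFtime hBtime t1
    omega
  · rw [hval]
    exact goodData_add hG hvw hw rfl rfl hreord.1 hreord.2

end Finish

/-! ### The potential of a configuration -/

section Potential

variable {n : ℕ}

/-- The invariant between arc additions, for `m` arc additions in total. -/
structure WaitInv (m : ℕ) (G : Data n) (todo : List (Fin n × Fin n)) : Prop where
  good : GoodData G
  nodup : todo.Nodup
  fresh : ∀ e ∈ todo, e ∉ arcSet G ∧ e.1 ≠ e.2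
  card : (arcSet G).card + todo.length = m

/-- The invariant of a search with traversed arcs `T`. -/
structure SearchInv (m : ℕ) (G : Data n) (v w : Fin n) (S : SearchState n)
    (todo : List (Fin n × Fin n)) (T : List ((Fin n × Fin n) × (Fin n × Fin n))) : Prop where
  wait : WaitInv m G ((v, w) :: todo)
  lt : G.order.idxOf w < G.order.idxOf v
  live : LiveInv (fun x => G.order.idxOf x) S
  trace : TraceInv G v w S T
  forward_head : S.FA = [] → S.FP = []
  backward_head : S.BA = [] → S.BP = []

/-- The potential of a graph with `l` arcs still to be added. -/
noncomputable def graphPot (m : ℕ) (q : ℝ) (G : Data n) (l : ℕ) : ℝ :=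
  -- `1000 * q` per pending arc and `1000 / q` per unrelated pair balance at completion of a search.
  -- The term `500 * m` keeps `tracePot` from being truncated at zero, as a search has fewer than
  -- `m` steps.
  1000 * q * l + 1000 * ((m : ℝ) ^ 2 - (relatedPairs G).card) / q + 500 * m

/-- The part of the potential of a search that does not depend on the live vertices. -/
noncomputable def tracePot (m : ℕ) (q : ℝ) (G : Data n) (l k : ℕ) : ℝ≥0∞ :=
  -- `500` covers the at most `302` units of time and live potential of one traversal step, and
  -- `400` the at most `281` units for starting a search.
  ENNReal.ofReal (graphPot m q G (l + 1) - 500 * k - 400)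

/-- The potential bounds the expected time that remains. -/
noncomputable def potential (m : ℕ) (q : ℝ) : Config n → ℝ≥0∞
  | .cycle _ => 0
  -- An infimum over proofs of the invariant is `⊤` where the invariant fails, so the potential
  -- carries the invariant with it. In a search the trace `T`, which the algorithm does not store,
  -- is a ghost variable under the infimum.
  | .waiting G todo => ⨅ _ : WaitInv m G todo, ENNReal.ofReal (graphPot m q G todo.length)
  | .searching G v w S todo => ⨅ T, ⨅ _ : SearchInv m G v w S todo T,
      tracePot m q G todo.length T.length + searchPot (fun x => G.order.idxOf x) S

theorem WaitInv.graphPot_ge {m : ℕ} {q : ℝ} (hq : 1 ≤ q) {G : Data n}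
    {todo : List (Fin n × Fin n)} (h : WaitInv m G todo) :
    1000 * todo.length + 500 * (m : ℝ) ≤ graphPot m q G todo.length := by
  have h1 : (relatedPairs G).card ≤ m ^ 2 :=
    (card_relatedPairs_le G).trans (Nat.pow_le_pow_left (by have := h.card; omega) 2)
  have h2 : ((relatedPairs G).card : ℝ) ≤ (m : ℝ) ^ 2 := by exact_mod_cast h1
  have h3 : 0 ≤ 1000 * ((m : ℝ) ^ 2 - (relatedPairs G).card) / q := by
    apply div_nonneg <;> linarith
  have h4 : (0 : ℝ) ≤ todo.length := Nat.cast_nonneg _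
  unfold graphPot
  nlinarith

theorem SearchInv.length_lt {m : ℕ} {G : Data n} {v w : Fin n} {S : SearchState n}
    {todo : List (Fin n × Fin n)} {T : List ((Fin n × Fin n) × (Fin n × Fin n))}
    (h : SearchInv m G v w S todo T) : T.length < m := by
  have h1 := h.trace.length_le
  have h2 := h.wait.card
  rw [List.length_cons] at h2
  omega

theorem natCast_add_ofReal_le (a : ℕ) {x y : ℝ} (hx : 0 ≤ x) (h : a + x ≤ y) :
    (a : ℝ≥0∞) + ENNReal.ofReal x ≤ ENNReal.ofReal y := by
  rw [← ENNReal.ofReal_natCast a, ← ENNReal.ofReal_add (Nat.cast_nonneg a) hx]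
  exact ENNReal.ofReal_le_ofReal h

theorem WaitInv.notMem {m : ℕ} {G : Data n} {v w : Fin n} {todo : List (Fin n × Fin n)}
    (h : WaitInv m G ((v, w) :: todo)) : w ∉ G.outList v :=
  fun hw => (h.fresh (v, w) (by simp)).1 (mem_arcSet.2 hw)

/-- The invariant is kept by the addition of an arc. -/
theorem WaitInv.add {m : ℕ} {G G' : Data n} {v w : Fin n} {todo : List (Fin n × Fin n)}
    (h : WaitInv m G ((v, w) :: todo)) (hG' : GoodData G')
    (hout : G'.outList = Function.update G.outList v (w :: G.outList v)) :
    WaitInv m G' todo := by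
  obtain ⟨hvw, hnd⟩ := List.nodup_cons.1 h.nodup
  have hw := h.notMem
  refine ⟨hG', hnd, ?_, ?_⟩
  · intro e he
    obtain ⟨h1, h2⟩ := h.fresh e (List.mem_cons_of_mem _ he)
    refine ⟨?_, h2⟩
    rw [arcSet_update hout, Finset.mem_insert, not_or]
    exact ⟨fun heq => hvw (heq ▸ he), h1⟩
  · have := h.card
    rw [card_arcSet_update hout hw]
    rw [List.length_cons] at this
    omega

/-- Both threshold updates together cost at most `5 + 5` beyond the potential; neither changes
visited vertices or pointers, so the trace survives. -/
theorem wp_updates_le {m : ℕ} {q : ℝ} {G : Data n} {v w : Fin n} {S S₁ : SearchState n}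
    {todo : List (Fin n × Fin n)} {T T' : List ((Fin n × Fin n) × (Fin n × Fin n))}
    (h : SearchInv m G v w S todo T) (hL : LiveInv (fun x => G.order.idxOf x) S₁)
    (hT : TraceInv G v w S₁ T') :
    ((updateForward G.order S₁).wp fun S₂ => (updateBackward G.order S₂).wp fun S₃ =>
      potential m q (.searching G v w S₃ todo)) ≤
    tracePot m q G todo.length T'.length +
      (searchPot (fun x => G.order.idxOf x) S₁ + 10 : ℕ) := by
  have hinj := h.wait.good.injective
  refine (wp_updateForward_le hinj hL _ (tracePot m q G todo.length T'.length + 5) ?_).trans ?_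
  · intro S₂ hL₂ hF₂ hS₂
    refine (wp_updateBackward_le hinj hL₂ hF₂ _ (tracePot m q G todo.length T'.length) ?_).trans ?_
    · intro S₃ hL₃ hF₃ hB₃ hS₃
      exact iInf₂_le T' ⟨h.wait, h.lt, hL₃, (hT.congr hS₂).congr hS₃, hF₃, hB₃⟩
    · push_cast
      rw [add_assoc, add_comm (5 : ℝ≥0∞)]
  · rw [add_assoc]
    refine add_le_add le_rfl ?_
    norm_cast
    omega

theorem startSearch_val (G : Data n) (v w : Fin n) :
    (startSearch G v w).val = ⟨[w], [v], if G.outList w = [] then [] else [w], [],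
      if G.inList v = [] then [] else [v], [], v, Function.update G.out w (G.outList w),
      Function.update G.inn v (G.inList v)⟩ := by
  by_cases h1 : G.outList w = [] <;> by_cases h2 : G.inList v = [] <;>
    simp [startSearch, h1, h2]

theorem startSearch_time (G : Data n) (v w : Fin n) : (startSearch G v w).time ≤ 8 := by
  by_cases h1 : G.outList w = [] <;> by_cases h2 : G.inList v = [] <;>
    simp [startSearch, h1, h2]

theorem startSearch_inv {m : ℕ} {G : Data n} {v w : Fin n} {todo : List (Fin n × Fin n)}
    (h : WaitInv m G ((v, w) :: todo)) (hlt : G.order.idxOf w < G.order.idxOf v) :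
    SearchInv m G v w (startSearch G v w).val todo [] ∧
    searchPot (fun x => G.order.idxOf x) (startSearch G v w).val ≤ 272 := by
  have hne : w ≠ v := by rintro rfl; exact lt_irrefl _ hlt
  rw [startSearch_val]
  refine ⟨⟨h, hlt, ⟨?_, ?_, by simp, by simp, ?_, ?_, ?_⟩, ⟨?_, ?_, by simpa using hne, by simp⟩,
    fun _ => rfl, fun _ => rfl⟩, ?_⟩
  · by_cases h1 : G.outList w = [] <;> simp [h1]
  · by_cases h1 : G.inList v = [] <;> simp [h1]
  · intro x hx
    by_cases h1 : G.outList w = []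
    · simp [h1] at hx
    · have : x = w := by simpa [h1] using hx
      subst this; simp [h1]
  · intro x hx
    by_cases h1 : G.inList v = []
    · simp [h1] at hx
    · have : x = v := by simpa [h1] using hx
      subst this; simp [h1]
  · intro x hx hox z hz hiz
    have hxw : x = w := by simpa using hx
    have hzv : z = v := by simpa using hz
    subst hxw hzv
    simp only [Function.update_self] at hox hiz
    simp [hox, hiz]
  · exact ⟨by simp, by simp, by simp [Relation.ReflTransGen.refl], by simp, by simp, by simp,
      by simp, by simp⟩
  · exact ⟨by simp, by simp, by simp [Relation.ReflTransGen.refl], by simp, by simp, by simp,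
      by simp, by simp⟩
  · have e1 : (if G.outList w = [] then [] else [w]).length ≤ 1 := by split <;> simp
    have e2 : (if G.inList v = [] then [] else [v]).length ≤ 1 := by split <;> simp
    have e3 := List.length_erase_le (a := v) (l := if G.outList w = [] then [] else [w])
    have e4 := List.length_erase_le (a := v) (l := if G.inList v = [] then [] else [v])
    have e5 := List.countP_le_length (p := fun x => decide (G.order.idxOf v < G.order.idxOf x))
      (l := if G.outList w = [] then [] else [w])
    have e6 := List.countP_le_length (p := fun x => decide (G.order.idxOf x < G.order.idxOf v))
      (l := if G.inList v = [] then [] else [v])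
    simp only [searchPot, List.length_nil]
    omega

/-- Starting a search costs at most `1 + 8` units of time and `272` of live potential, within the
`400` set aside. A plain insertion is paid for by its share `1000 * q`. -/
theorem wp_step_waiting_le (σ : ChoiceRule n) (h : List (Config n)) {m : ℕ} {q : ℝ} (hq : 1 ≤ q)
    {G : Data n} {v w : Fin n} {todo : List (Fin n × Fin n)}
    (hinv : WaitInv m G ((v, w) :: todo)) :
    (step σ h (.waiting G ((v, w) :: todo))).wp (potential m q) ≤
      ENNReal.ofReal (graphPot m q G (todo.length + 1)) := by
  have hge := hinv.graphPot_ge hq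
  rw [List.length_cons] at hge
  push_cast at hge
  by_cases hlt : G.order.idxOf w < G.order.idxOf v
  · have hwp : (step σ h (.waiting G ((v, w) :: todo))).wp (potential m q) =
        (1 : ℕ) + ((startSearch G v w).time + potential m q
          (.searching G v w (startSearch G v w).val todo)) := by
      simp [step, Rand.wp_bind, Rand.wp_lift, Rand.wp_pure, hlt]
    obtain ⟨h1, h2⟩ := startSearch_inv hinv hlt
    have h3 := startSearch_time G v w
    have h4 : potential m q (.searching G v w (startSearch G v w).val todo) ≤ _ :=
      iInf₂_le [] h1
    rw [hwp]
    calc _ ≤ ((1 : ℕ) : ℝ≥0∞) + ((8 : ℕ) + (tracePot m q G todo.length 0 + (272 : ℕ))) := by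
          gcongr
          refine h4.trans ?_
          gcongr
          rfl
      _ = (281 : ℕ) + tracePot m q G todo.length 0 := by push_cast; ring
      _ ≤ _ := by
          have h0 : (0 : ℝ) ≤ todo.length := Nat.cast_nonneg _
          have h0' : (0 : ℝ) ≤ m := Nat.cast_nonneg _
          apply natCast_add_ofReal_le
          · push_cast; linarith
          · push_cast; linarith
  · have hw := hinv.notMem
    have hvw : v ≠ w := (hinv.fresh _ (by simp : (v, w) ∈ (v, w) :: todo)).2
    have hwp : (step σ h (.waiting G ((v, w) :: todo))).wp (potential m q) =
        (1 : ℕ) + ((2 : ℕ) + potential m q (.waiting (addArc v w G).val todo)) := by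
      have ht : (addArc v w G).time = 2 := rfl
      simp [step, Rand.wp_bind, Rand.wp_lift, Rand.wp_pure, hlt, ht]
    have hout : (addArc v w G).val.outList =
      Function.update G.outList v (w :: G.outList v) := rfl
    have hgood : GoodData (addArc v w G).val := by
      refine goodData_add hinv.good hvw hw hout rfl (List.Perm.refl _) ?_
      refine (pairwise_idxOf_lt hinv.good.nodup).imp ?_
      rintro a b hab (hor | ⟨rfl, rfl⟩)
      · have := hinv.good.topological _ _ hor
        omega
      · exact hlt hab
    have hnew := hinv.add hgood hout
    have h4 : potential m q (.waiting (addArc v w G).val todo) ≤ _ := iInf_le _ hnew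
    have h5 := Finset.card_le_card (relatedPairs_subset_update hout)
    have h6 : ((relatedPairs G).card : ℝ) ≤ (relatedPairs (addArc v w G).val).card := by
      exact_mod_cast h5
    have h7 : 1000 * ((m : ℝ) ^ 2 - (relatedPairs (addArc v w G).val).card) / q ≤
        1000 * ((m : ℝ) ^ 2 - (relatedPairs G).card) / q := by
      gcongr
    have hge' := hnew.graphPot_ge hq
    rw [hwp]
    calc _ ≤ ((1 : ℕ) : ℝ≥0∞) + ((2 : ℕ) +
          ENNReal.ofReal (graphPot m q (addArc v w G).val todo.length)) := by gcongr
      _ = (3 : ℕ) + ENNReal.ofReal (graphPot m q (addArc v w G).val todo.length) := by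
          push_cast; ring
      _ ≤ _ := by
          apply natCast_add_ofReal_le
          · refine le_trans ?_ hge'
            positivity
          · unfold graphPot
            push_cast
            linarith

/-- The `k ^ 2 / 2` new related pairs refund the `500 * k` charged during the search and pay for the
linear-time reordering. -/
theorem wp_step_finish_le (σ : ChoiceRule n) (h : List (Config n)) {m : ℕ} {q : ℝ} (hq : 1 ≤ q)
    {G : Data n} {v w : Fin n} {S : SearchState n} {todo : List (Fin n × Fin n)}
    {T : List ((Fin n × Fin n) × (Fin n × Fin n))} (hinv : SearchInv m G v w S todo T)
    (hend : S.FA = [] ∨ S.BA = []) :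
    (step σ h (.searching G v w S todo)).wp (potential m q) ≤
      tracePot m q G todo.length T.length := by
  have hw := hinv.wait.notMem
  obtain ⟨f1, f2, f3⟩ := finish_spec hinv.wait.good hinv.live hinv.trace
    (hend.imp (fun h => ⟨h, hinv.forward_head h⟩) fun h => ⟨h, hinv.backward_head h⟩) hinv.lt hw
  have hwp : (step σ h (.searching G v w S todo)).wp (potential m q) =
      (1 : ℕ) + ((1 : ℕ) + ((finish G v w S).time +
        potential m q (.waiting (finish G v w S).val todo))) := by
    have hc : (S.FA.isEmpty || S.BA.isEmpty) = true := by simpa using hend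
    simp only [step, Rand.wp_bind, Rand.wp_lift, isEmpty_val, isEmpty_time, hc, if_true,
      Rand.wp_pure]
  have hnew := hinv.wait.add f2 f3
  have h4 : potential m q (.waiting (finish G v w S).val todo) ≤ _ := iInf_le _ hnew
  have h5 := card_relatedPairs_update hinv.wait.good hinv.trace f3
  have h6 : 2 * ((relatedPairs G).card : ℝ) + (T.length : ℝ) ^ 2 ≤
      2 * (relatedPairs (finish G v w S).val).card := by exact_mod_cast h5
  have hge' := hnew.graphPot_ge hq
  have hq0 : 0 < q := by linarith
  rw [hwp]
  calc _ ≤ ((1 : ℕ) : ℝ≥0∞) + ((1 : ℕ) + ((50 * (T.length + 1) : ℕ) +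
        ENNReal.ofReal (graphPot m q (finish G v w S).val todo.length))) := by gcongr
    _ = (50 * (T.length + 1) + 2 : ℕ) +
        ENNReal.ofReal (graphPot m q (finish G v w S).val todo.length) := by push_cast; ring
    _ ≤ _ := by
        apply natCast_add_ofReal_le
        · refine le_trans ?_ hge'
          positivity
        · have h7 : 1000 * ((m : ℝ) ^ 2 - (relatedPairs (finish G v w S).val).card) / q ≤
              1000 * ((m : ℝ) ^ 2 - (relatedPairs G).card) / q -
                500 * (T.length : ℝ) ^ 2 / q := by
            rw [← sub_div]
            gcongr
            linarith
          -- Arithmetic–geometric mean inequality, from `(k - q) ^ 2 ≥ 0`; `500 * q` is charged to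
          -- the completed arc addition.
          have h8 : 1000 * (T.length : ℝ) - 500 * q ≤ 500 * (T.length : ℝ) ^ 2 / q := by
            rw [le_div_iff₀ hq0]
            nlinarith [sq_nonneg ((T.length : ℝ) - q)]
          have h9 : (0 : ℝ) ≤ T.length := Nat.cast_nonneg _
          unfold graphPot
          push_cast
          linarith

/-- A traversal is paid for by `tracePot`. A passive move takes at most `20` units, updates
included, against a drop of `23` in `searchPot`. If a cycle is reported the remaining potential is
released. -/
theorem wp_step_loop_le (σ : ChoiceRule n) (h : List (Config n)) {m : ℕ} {q : ℝ} (hq : 1 ≤ q)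
    {G : Data n} {v w : Fin n} {S : SearchState n} {todo : List (Fin n × Fin n)}
    {T : List ((Fin n × Fin n) × (Fin n × Fin n))} (hinv : SearchInv m G v w S todo T)
    (hFA : S.FA ≠ []) (hBA : S.BA ≠ []) :
    (step σ h (.searching G v w S todo)).wp (potential m q) ≤
      tracePot m q G todo.length T.length + searchPot (fun x => G.order.idxOf x) S := by
  have hc : (S.FA.isEmpty || S.BA.isEmpty) = false := by simp [hFA, hBA]
  have hu := σ.fst_mem (.searching G v w S todo :: h) S hFA
  have hz := σ.snd_mem (.searching G v w S todo :: h) S hBA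
  set u := (σ.pick (.searching G v w S todo :: h) S).1 with hu_def
  set z := (σ.pick (.searching G v w S todo :: h) S).2 with hz_def
  have hge := hinv.wait.graphPot_ge hq
  rw [List.length_cons] at hge
  push_cast at hge
  have h0 : (0 : ℝ) ≤ todo.length := Nat.cast_nonneg _
  by_cases hlt : G.order.idxOf u < G.order.idxOf z
  · obtain ⟨s1, s2⟩ := searchStep_spec hinv.wait.good hinv.live hinv.trace hu hz hlt
    have hlen : (T.length : ℝ) + 1 ≤ m := by exact_mod_cast hinv.length_lt
    rcases s2 with ⟨a, ha⟩ | ⟨S', e, hval, hL, hT, hpot⟩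
    · have hwp : (step σ h (.searching G v w S todo)).wp (potential m q) =
          (4 + (searchStep G u z S).time : ℕ) + 0 := by
        simp only [step, Rand.wp_bind, Rand.wp_lift, isEmpty_val, isEmpty_time, hc,
          Bool.false_eq_true, if_false, ← hu_def, ← hz_def, less_val, less_time, hlt,
          decide_true, if_true, ha, Rand.wp_pure, potential, Timed.time_tick]
        push_cast; ring
      rw [hwp]
      calc ((4 + (searchStep G u z S).time : ℕ) : ℝ≥0∞) + 0 ≤
            (20 : ℕ) + ENNReal.ofReal 0 := by
            rw [ENNReal.ofReal_zero]; gcongr; omega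
        _ ≤ tracePot m q G todo.length T.length := by
            apply natCast_add_ofReal_le _ le_rfl
            push_cast
            linarith
        _ ≤ _ := le_self_add
    · have hwp : (step σ h (.searching G v w S todo)).wp (potential m q) =
          (4 + (searchStep G u z S).time : ℕ) +
            (updateForward G.order S').wp fun S₂ => (updateBackward G.order S₂).wp fun S₃ =>
              potential m q (.searching G v w S₃ todo) := by
        simp only [step, Rand.wp_bind, Rand.wp_lift, isEmpty_val, isEmpty_time, hc,
          Bool.false_eq_true, if_false, ← hu_def, ← hz_def, less_val, less_time, hlt,
          decide_true, if_true, hval, Rand.wp_pure, Timed.time_tick]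
        push_cast; ring
      rw [hwp]
      have hup := wp_updates_le (q := q) hinv hL hT
      calc _ ≤ ((20 : ℕ) : ℝ≥0∞) + (tracePot m q G todo.length (e :: T).length +
            (searchPot (fun x => G.order.idxOf x) S + 282 : ℕ)) := by
            refine add_le_add ?_ (hup.trans ?_)
            · gcongr; omega
            · exact add_le_add le_rfl (Nat.cast_le.2 (by omega))
        _ = ((302 : ℕ) + tracePot m q G todo.length (e :: T).length) +
            searchPot (fun x => G.order.idxOf x) S := by push_cast; ring
        _ ≤ _ := by
            gcongr
            apply natCast_add_ofReal_le
            · rw [List.length_cons]; push_cast; linarith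
            · rw [List.length_cons]; push_cast; linarith
  · have hne : u ≠ z := by
      intro huz
      exact hinv.trace.disjoint u (hinv.live.live_F u (Or.inl hu)).1
        (huz ▸ (hinv.live.live_B z (Or.inl hz)).1)
    have hlt' : G.order.idxOf z < G.order.idxOf u := by
      have : G.order.idxOf u ≠ G.order.idxOf z := fun h => hne (hinv.wait.good.injective h)
      omega
    obtain ⟨p1, p2, p3, p4⟩ := makePassive_spec hinv.live hu hz hlt'
    have hwp : (step σ h (.searching G v w S todo)).wp (potential m q) =
        (4 + (makePassive G.order u z S).time : ℕ) +
          (updateForward G.order (makePassive G.order u z S).val).wp fun S₂ =>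
            (updateBackward G.order S₂).wp fun S₃ =>
              potential m q (.searching G v w S₃ todo) := by
      simp only [step, Rand.wp_bind, Rand.wp_lift, isEmpty_val, isEmpty_time, hc,
        Bool.false_eq_true, if_false, ← hu_def, ← hz_def, less_val, less_time, hlt,
        decide_false, Rand.wp_pure, Timed.time_tick]
      push_cast; ring
    rw [hwp]
    have hup := wp_updates_le (q := q) hinv p1 (hinv.trace.congr p2)
    refine (add_le_add_right hup _).trans ?_
    rw [add_left_comm]
    gcongr
    norm_cast
    omega

/-- No step increases the sum of the time spent and the potential, in expectation. -/
theorem wp_step_le (σ : ChoiceRule n) (h : List (Config n)) {m : ℕ} {q : ℝ} (hq : 1 ≤ q)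
    (c : Config n) : (step σ h c).wp (potential m q) ≤ potential m q c := by
  match c with
  | .cycle a => exact (Rand.wp_pure _ _).le
  | .waiting G [] => exact (Rand.wp_pure _ _).le
  | .waiting G ((v, w) :: todo) =>
    refine le_iInf fun hinv => ?_
    exact wp_step_waiting_le σ h hq hinv
  | .searching G v w S todo =>
    refine le_iInf₂ fun T hinv => ?_
    by_cases hend : S.FA = [] ∨ S.BA = []
    · exact (wp_step_finish_le σ h hq hinv hend).trans le_self_add
    · rw [not_or] at hend
      exact wp_step_loop_le σ h hq hinv hend.1 hend.2

theorem wp_run_le (σ : ChoiceRule n) (order : List (Fin n)) (arcs : List (Fin n × Fin n))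
    {m : ℕ} {q : ℝ} (hq : 1 ≤ q) (k : ℕ) :
    (run σ order arcs k).wp (fun r => potential m q r.2) ≤
      (3 * order.length : ℕ) + potential m q (.waiting (emptyGraph order).val arcs) := by
  induction k with
  | zero =>
    have ht : (emptyGraph order).time = 3 * order.length := by
      have : (emptyGraph order).time =
        (order.forM fun _ => (do tick; tick; tick : Timed Unit)).time := rfl
      rw [this, forM_tick_time]
      rfl
    simp only [run, Rand.wp_bind, Rand.wp_lift, Rand.wp_pure, ht]
    exact le_rfl
  | succ k ih =>
    refine le_trans ?_ ih
    simp only [run, Rand.wp_bind, Rand.wp_pure]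
    exact Rand.wp_mono _ fun r => wp_step_le σ r.1 hq r.2

theorem waitInv_init {order : List (Fin n)} {arcs : List (Fin n × Fin n)} (hnd : arcs.Nodup)
    (hne : ∀ a ∈ arcs, a.1 ≠ a.2) (hord : order.Nodup) (hall : ∀ x, x ∈ order) :
    WaitInv arcs.length (emptyGraph order).val arcs := by
  have hG : (emptyGraph order).val =
    ⟨fun _ => [], fun _ => [], order, fun _ => [], fun _ => []⟩ := rfl
  have harcs : arcSet (emptyGraph order).val = ∅ := by
    ext e
    simp [mem_arcSet, hG]
  refine ⟨?_, hnd, ?_, ?_⟩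
  · rw [hG]
    exact ⟨hord, hall, by simp, by simp, by simp, by simp⟩
  · intro e he
    rw [harcs]
    exact ⟨by simp, hne e he⟩
  · rw [harcs]; simp

theorem expectedTime_le (σ : ChoiceRule n) {order : List (Fin n)} {arcs : List (Fin n × Fin n)}
    (hnd : arcs.Nodup) (hne : ∀ a ∈ arcs, a.1 ≠ a.2) (hord : order.Nodup)
    (hall : ∀ x, x ∈ order) {q : ℝ} (hq : 1 ≤ q) :
    expectedTime σ order arcs ≤ ENNReal.ofReal (3 * n + (1000 * q * arcs.length +
      1000 * (arcs.length : ℝ) ^ 2 / q + 500 * arcs.length)) := by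
  have hlen : order.length ≤ n := by
    simpa using hord.length_le_card
  have hinv := waitInv_init hnd hne hord hall
  have h1 : potential arcs.length q (.waiting (emptyGraph order).val arcs) ≤ _ :=
    iInf_le _ hinv
  refine iSup_le fun k => (Rand.expectedCost_le_wp _ _).trans
    ((wp_run_le (m := arcs.length) σ order arcs hq k).trans ?_)
  refine (add_le_add_right h1 _).trans ?_
  have h2 : graphPot arcs.length q (emptyGraph order).val arcs.length ≤
      1000 * q * arcs.length + 1000 * (arcs.length : ℝ) ^ 2 / q + 500 * arcs.length := by
    unfold graphPot
    gcongr
    exact sub_le_self _ (Nat.cast_nonneg _)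
  apply natCast_add_ofReal_le
  · refine le_trans ?_ (hinv.graphPot_ge hq)
    positivity
  · have : (order.length : ℝ) ≤ n := by exact_mod_cast hlen
    push_cast
    linarith

end Potential

end SoftThreshold

/-! ### Choice of the balancing parameter -/

theorem mainTheorem5 (c : ℝ) :
    ∃ C : ℝ, ∀ (n : ℕ) (arcs : List (Fin n × Fin n)) (order : List (Fin n))
      (σ : SoftThreshold.ChoiceRule n),
      arcs.Nodup → (∀ a ∈ arcs, a.1 ≠ a.2) →
      order.Nodup → (∀ x, x ∈ order) →
      (n : ℝ) ≤ c * (arcs.length : ℝ) →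
      SoftThreshold.expectedTime σ order arcs ≤
        ENNReal.ofReal (C * (arcs.length : ℝ) ^ (3 / 2 : ℝ)) := by
  -- With `q = √m` the bound is `3 * n + 1000 * m * √m + 1000 * m * √m + 500 * m`, where `n ≤ |c| *
  -- m` and `m ≤ m * √m`.
  refine ⟨2500 + 3 * |c|, fun n arcs order σ hnd hne hord hall hn => ?_⟩
  set m : ℝ := (arcs.length : ℝ) with hm
  have hm0 : 0 ≤ m := Nat.cast_nonneg _
  have hnc : (n : ℝ) ≤ |c| * m := hn.trans (mul_le_mul_of_nonneg_right (le_abs_self c) hm0)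
  have hpow : m ^ (3 / 2 : ℝ) = m * Real.sqrt m := by
    rcases hm0.eq_or_lt with h | h
    · rw [← h, Real.zero_rpow (by norm_num)]; simp
    · rw [Real.sqrt_eq_rpow, show (3 / 2 : ℝ) = 1 + 1 / 2 by norm_num, Real.rpow_add h,
        Real.rpow_one]
  rw [hpow]
  -- Without arcs `√m` is not at least `1`; then `q = 1` will do, since `n = 0`.
  rcases Nat.eq_zero_or_pos arcs.length with h | h
  · have hmz : m = 0 := by rw [hm, h]; simp
    refine (SoftThreshold.expectedTime_le σ hnd hne hord hall le_rfl).trans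
      (ENNReal.ofReal_le_ofReal ?_)
    rw [← hm, hmz]
    rw [hmz] at hnc
    linarith
  · have hm1 : 1 ≤ m := by rw [hm]; exact_mod_cast h
    have hq : 1 ≤ Real.sqrt m := Real.one_le_sqrt.2 hm1
    refine (SoftThreshold.expectedTime_le σ hnd hne hord hall hq).trans
      (ENNReal.ofReal_le_ofReal ?_)
    rw [← hm]
    have h1 : m ^ 2 / Real.sqrt m = m * Real.sqrt m := by
      rw [sq, mul_div_assoc, Real.div_sqrt]
    have h2 : m ≤ m * Real.sqrt m := le_mul_of_one_le_right hm0 hq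
    have h3 : |c| * m ≤ |c| * (m * Real.sqrt m) := mul_le_mul_of_nonneg_left h2 (abs_nonneg c)
    rw [mul_div_assoc, h1]
    nlinarith
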